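/- Let $|\cdot|$ be Lebesgue measure on $[-\pi,\pi]$ and let $L^1([-\pi,\pi])$ be the space of complex-valued integrable functions. Let $\{\varphi_n\}_{n=1}^\infty$ be the trigonometric system $e^{ikx}$, $k\in\mathbb Z$, enumerated in the order $k=0,1,-1,2,-2,\dots$; if $\varphi_n(x)=e^{ikx}$, let $c_n(U)=\frac1{2\pi}\int_{-\pi}^{\pi}U(x)e^{-ikx}\,dx$ be the corresponding Fourier coefficient of $U\in L^1([-\pi,\pi])$. A function $U\in L^1([-\pi,\pi])$ is called asymptotically conditionally universal for $L^1([-\pi,\pi])$ with respect to the trigonometric system if there exist signs $\delta_n\in\{1,-1\}$, $n\in\mathbb N$, and measurable sets $F_1\subset F_2\subset\dots\subset[-\pi,\pi]$ with $\lim_{m\to\infty}|[-\pi,\pi]\setminus F_m|=0$, such that for every $g\in L^1([-\pi,\pi])$ there are natural numbers $N_1<N_2<\dots$ with $$\lim_{q\to\infty}\int_{F_m}\Bigl|\sum_{n=1}^{N_q}\delta_n c_n(U)\varphi_n(x)-g(x)\Bigr|\,dx=0\qquad\text{for all } m\in\mathbb N .$$ Then for every $\varepsilon>0$ there exists a measurable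 set $E\subset[-\pi,\pi]$ with $|[-\pi,\pi]\setminus E|<\varepsilon$ such that for every $f\in L^1([-\pi,\pi])$ there is a function $U\in L^1([-\pi,\pi])$ with $U(x)=f(x)$ for all $x\in E$ which is asymptotically conditionally universal for $L^1([-\pi,\pi])$ with respect to the trigonometric system. -/

import Mathlib

open Real Set Filter Topology MeasureTheory

/-- A minimal system `φ` in the complex space `L¹(μ)`, together with a biorthonormal system `ψ`
in the dual space `L^∞(μ)`: `∫ φ_m ψ_n dμ = δ_{m,n}`. Sequences are indexed from `0`. -/
structure BiorthonormalSystem {M : Type*} [MeasurableSpace M] (μ : Measure M) where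
  /-- the elements of the system -/
  φ : ℕ → M → ℂ
  /-- the dual system, representing the Fourier coefficient functionals -/
  ψ : ℕ → M → ℂ
  integrable_φ : ∀ n, Integrable (φ n) μ
  memLp_top_ψ : ∀ n, MemLp (ψ n) ⊤ μ
  biorthonormal : ∀ m n, ∫ x, φ m x * ψ n x ∂μ = if m = n then 1 else 0

namespace BiorthonormalSystem

variable {M : Type*} [MeasurableSpace M] {μ : Measure M}

/-- The Fourier coefficient `c_n(f)` of `f ∈ L¹(μ)` with respect to the system. -/
noncomputable def coeff (S : BiorthonormalSystem μ) (n : ℕ) (f : M → ℂ) : ℂ :=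
  ∫ x, f x * S.ψ n x ∂μ

/-- `U ∈ L¹(μ)` is asymptotically conditionally universal for `L¹(μ)` with respect to the system,
with multipliers from `G`: there are `G`-values `δ_n` and an increasing sequence of measurable sets
`F_m` with `μ(F_mᶜ) → 0` such that for every `f ∈ L¹(μ)` some subsequence of the partial sums of
`∑ δ_n c_n(U) φ_n` converges to `f` in `L¹(F_m)` for all `m` simultaneously. -/
def IsAsymCondUniversal (S : BiorthonormalSystem μ) (G : Set ℂ) (U : M → ℂ) : Prop :=
  Integrable U μ ∧
  ∃ δ : ℕ → ℂ, (∀ n, δ n ∈ G) ∧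
  ∃ F : ℕ → Set M, (∀ m, MeasurableSet (F m)) ∧ Monotone F ∧
    Tendsto (fun m => μ (F m)ᶜ) atTop (𝓝 0) ∧
    ∀ f : M → ℂ, Integrable f μ →
      ∃ N : ℕ → ℕ, StrictMono N ∧ ∀ m,
        Tendsto (fun q => ∫ x in F m,
            ‖(∑ n ∈ Finset.range (N q), δ n * S.coeff n U * S.φ n x) - f x‖ ∂μ)
          atTop (𝓝 0)

end BiorthonormalSystem

/-- Lebesgue measure on the interval `[-π, π]`. -/
noncomputable abbrev volPi : Measure ℝ := volume.restrict (Icc (-π) π)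

/-- The enumeration `0, 1, -1, 2, -2, …` of the integers. -/
def trigFreq (n : ℕ) : ℤ := -(Equiv.intEquivNat.symm n)

theorem trigFreq_injective : Function.Injective trigFreq := fun _ _ h =>
  Equiv.intEquivNat.symm.injective (neg_injective h)

theorem integral_exp_volPi (k : ℤ) :
    ∫ x, Complex.exp (Complex.I * k * (x : ℂ)) ∂volPi = if k = 0 then (2 * π : ℂ) else 0 := by
  have hle : -π ≤ π := by linarith [Real.pi_pos]
  rw [integral_Icc_eq_integral_Ioc, ← intervalIntegral.integral_of_le hle]
  split_ifs with hk
  · subst hk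
    simp only [Int.cast_zero, mul_zero, zero_mul, Complex.exp_zero,
      intervalIntegral.integral_const]
    rw [sub_neg_eq_add, Complex.real_smul]
    push_cast
    ring
  · have hk' : Complex.I * (k : ℂ) ≠ 0 := by simp [hk]
    rw [integral_exp_mul_complex hk', div_eq_zero_iff]
    left
    rw [sub_eq_zero, Complex.exp_eq_exp_iff_exists_int]
    exact ⟨k, by push_cast; ring⟩

/-- The trigonometric system `e^{ikx}`, `k ∈ ℤ`, on `[-π, π]`, in the order
`k = 0, 1, -1, 2, -2, …`; its Fourier coefficients are `(1 / 2π) ∫ f(x) e^{-ikx} dx`. -/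
noncomputable def trigSystem : BiorthonormalSystem volPi where
  φ n x := Complex.exp (Complex.I * trigFreq n * (x : ℂ))
  ψ n x := (2 * π : ℂ)⁻¹ * Complex.exp (-(Complex.I * trigFreq n * (x : ℂ)))
  integrable_φ n := (Continuous.continuousOn (by fun_prop)).integrableOn_compact isCompact_Icc
  memLp_top_ψ n := by
    refine memLp_top_of_bound (Continuous.aestronglyMeasurable (by fun_prop))
      ‖(2 * π : ℂ)⁻¹‖ (Eventually.of_forall fun x => ?_)
    rw [norm_mul, Complex.norm_exp]
    simp
  biorthonormal m n := by
    have h : ∀ x : ℝ, Complex.exp (Complex.I * trigFreq m * (x : ℂ)) *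
        ((2 * π : ℂ)⁻¹ * Complex.exp (-(Complex.I * trigFreq n * (x : ℂ)))) =
        (2 * π : ℂ)⁻¹ * Complex.exp (Complex.I * (trigFreq m - trigFreq n : ℤ) * (x : ℂ)) := by
      intro x
      rw [mul_left_comm, ← Complex.exp_add]
      push_cast
      ring_nf
    have hpi : (2 * π : ℂ) ≠ 0 := by simp [Real.pi_ne_zero]
    simp only [h]
    rw [integral_const_mul, integral_exp_volPi]
    simp only [sub_eq_zero, trigFreq_injective.eq_iff]
    split_ifs
    · exact inv_mul_cancel₀ hpi
    · simp

/-!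
A signed Fourier series can behave quite differently from the series itself: there are trigonometric
polynomials `Q` with arbitrarily small `L¹` norm and arbitrarily high spectrum such that a change of
signs of the coefficients turns `Q` into an approximation, off a small set, of any prescribed
integrable function (`exists_small_signMul_near_integrable`). Adding such polynomials to a
convergent series costs almost nothing in `L¹`, but steers the signed partial sums at will.

The construction of `Q` rests on Fejér's lemma `∫ f(x) V(mx) dx → ∫ f ∫ V` for normalized measure,
which makes a high dilation asymptotically independent of a fixed function.
* Products of `k` factors `1 + e^{imx}` with lacunary `m` have an `L¹` norm exponentially smaller
  than their `L²` norm, while a Rudin–Shapiro choice of signs makes them bounded by a multiple of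
  the latter. After normalization this gives `s` with `‖s‖₁` tiny and a real sign transform `t`
  with `|t| ≤ 1`, mean zero and `∫ t² ≥ 1/4` (`exists_small_signMul_large`).
* The Riesz product `Π = ∏ (1 + t(mᵢx))` is nonnegative of mean `1`, but `∫ √Π` decays
  exponentially in the number of factors, at a rate that does not depend on `s`. Hence `1 - Π` is
  close to `1` off a small set. Expanding the product, `1 - Π` is a sign transform of a polynomial
  `R` whose `L¹` norm is controlled by that of `s`, hence tiny (`exists_small_signMul_near_one`).
* For a polynomial `p`, the product `p(x) R(mx)` is then the required `Q`.
The polynomial `1 - Π` itself, of mean zero and `L¹` norm at most `2`, yields approximations of `p`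
by `p(x) (1 - Π)(mx)`: high spectrum, norm at most about `2 ‖p‖₁`, small error off a small set
(`exists_high_spectrum_near_integrable`). Doing this for a countable dense family of functions, all
spectral bounds and all tolerances, with summably small exceptional sets, defines the set `E`.

Given `f`, blocks `Q₁ + Q₂` of increasing spectrum are added successively: `Q₁`, with signs `1`,
approximates on `E` what is missing from `f`, and `Q₂`, negligible in `L¹`, is chosen so that the
signed sum comes close to the next member of a sequence visiting a dense set infinitely often
(`SignedPoly.exists_extension`). The series converges in `L¹` to a function that equals `f` on `E`
and whose signed Fourier series is universal.
-/

/-! ### Coefficients, evaluation and sign multipliers -/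

open AddCircle

instance fact_two_pi_pos : Fact (0 < 2 * π) := ⟨Real.two_pi_pos⟩

/-- The circle `ℝ / 2πℤ`. -/
abbrev Torus : Type := AddCircle (2 * π)

/-- Normalized Haar measure on the circle. -/
noncomputable abbrev torusMeasure : Measure Torus := haarAddCircle

/-- A finitely supported family of coefficients, viewed as the trigonometric polynomial
`∑ p k e^{ikx}` on the circle. -/
noncomputable def trigEval : (ℤ →₀ ℂ) →ₗ[ℂ] C(Torus, ℂ) :=
  Finsupp.linearCombination ℂ (fun k => fourier k)

/-- The sign multiplier `∑ p k e^{ikx} ↦ ∑ δ k p k e^{ikx}`, acting on coefficients. -/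
noncomputable def signMul (δ : ℤ → ℤˣ) : (ℤ →₀ ℂ) →ₗ[ℂ] (ℤ →₀ ℂ) where
  toFun p := Finsupp.onFinset p.support (fun k => ((δ k : ℤ) : ℂ) * p k) fun k hk => by
    simpa using right_ne_zero_of_mul hk
  map_add' p q := by ext k; simp [mul_add]
  map_smul' c p := by ext k; simp [mul_left_comm]

@[simp]
theorem signMul_apply (δ : ℤ → ℤˣ) (p : ℤ →₀ ℂ) (k : ℤ) :
    signMul δ p k = ((δ k : ℤ) : ℂ) * p k := rfl

@[simp]
theorem signMul_one (p : ℤ →₀ ℂ) : signMul 1 p = p := by ext k; simp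

theorem signMul_single (δ : ℤ → ℤˣ) (k : ℤ) (a : ℂ) :
    signMul δ (Finsupp.single k a) = Finsupp.single k (((δ k : ℤ) : ℂ) * a) := by
  ext l
  rw [signMul_apply]
  by_cases h : k = l
  · subst h; simp
  · simp [Finsupp.single_eq_of_ne' h]

/-- The coefficients of the trigonometric polynomial `p(x) s(mx)`. -/
noncomputable def dilMul (m : ℕ) (p s : ℤ →₀ ℂ) : ℤ →₀ ℂ :=
  p.sum fun l a => s.sum fun j b => Finsupp.single (l + m * j) (a * b)

theorem trigEval_apply (p : ℤ →₀ ℂ) (x : Torus) :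
    trigEval p x = p.sum fun k a => a * fourier k x := by
  simp [trigEval, Finsupp.linearCombination_apply, Finsupp.sum]

@[simp]
theorem trigEval_single (k : ℤ) (a : ℂ) (x : Torus) :
    trigEval (Finsupp.single k a) x = a * fourier k x := by
  simp [trigEval]

theorem fourier_add_mul (m : ℕ) (l j : ℤ) (x : Torus) :
    fourier (l + m * j) x = fourier l x * fourier j (m • x) := by
  rw [fourier_add]
  have h : ((m : ℤ) * j) • x = j • m • x := by
    rw [mul_comm (m : ℤ) j, mul_zsmul, natCast_zsmul]
  simp only [fourier_apply, h]

theorem trigEval_dilMul (m : ℕ) (p s : ℤ →₀ ℂ) (x : Torus) :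
    trigEval (dilMul m p s) x = trigEval p x * trigEval s (m • x) := by
  rw [trigEval_apply p, trigEval_apply s]
  simp only [dilMul, Finsupp.sum, map_sum, ContinuousMap.sum_apply, trigEval_single,
    Finset.sum_mul_sum, fourier_add_mul]
  refine Finset.sum_congr rfl fun l _ => Finset.sum_congr rfl fun j _ => by ring

/-- Every trigonometric polynomial has a degree bound. -/
theorem exists_degree_bound (p : ℤ →₀ ℂ) : ∃ d : ℕ, ∀ k, p k ≠ 0 → |k| ≤ d := by
  refine ⟨p.support.sup Int.natAbs, fun k hk => ?_⟩
  have := Finset.le_sup (f := Int.natAbs) (Finsupp.mem_support_iff.2 hk)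
  rw [Int.abs_eq_natAbs]
  exact_mod_cast this

/-- Dilating a mean-zero factor pushes the spectrum of the product beyond any given frequency. -/
theorem eventually_dilMul_eq_zero (p s : ℤ →₀ ℂ) (hs : s 0 = 0) (N : ℕ) :
    ∀ᶠ m : ℕ in atTop, ∀ k : ℤ, |k| ≤ N → dilMul m p s k = 0 := by
  obtain ⟨d, hd⟩ := exists_degree_bound p
  filter_upwards [eventually_gt_atTop (N + d)] with m hm k hk
  simp only [dilMul, Finsupp.sum, Finsupp.finsetSum_apply]
  refine Finset.sum_eq_zero fun l hl => Finset.sum_eq_zero fun j hj => ?_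
  refine Finsupp.single_eq_of_ne' fun h => ?_
  have hl' := hd l (Finsupp.mem_support_iff.1 hl)
  have hj' : j ≠ 0 := by
    rintro rfl
    exact Finsupp.mem_support_iff.1 hj hs
  have h1 : (m : ℤ) * 1 ≤ m * |j| :=
    mul_le_mul_of_nonneg_left (Int.one_le_abs hj') (by positivity)
  have h2 : (m : ℤ) * |j| = |k - l| := by
    rw [← h, add_sub_cancel_left, abs_mul, Nat.abs_cast]
  have h3 := abs_sub k l
  omega

/-- For large `m` the frequency `l + m j` of `p(x) s(mx)` determines `l` and `j`, so that sign
multipliers acting on the two factors combine to one acting on the product. -/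
theorem eventually_exists_signMul_dilMul (p s : ℤ →₀ ℂ) (α β : ℤ → ℤˣ) :
    ∀ᶠ m : ℕ in atTop, ∃ σ : ℤ → ℤˣ,
      signMul σ (dilMul m p s) = dilMul m (signMul α p) (signMul β s) := by
  obtain ⟨d, hd⟩ := exists_degree_bound p
  filter_upwards [eventually_gt_atTop (2 * d)] with m hm
  -- Since `|l| ≤ d` and `2d < m`, the frequency `k = l + mj` has `j = ⌊(k + d) / m⌋`.
  refine ⟨fun k => α (k - m * ((k + d) / m)) * β ((k + d) / m), ?_⟩
  have hdil : dilMul m (signMul α p) (signMul β s) =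
      ∑ l ∈ p.support, ∑ j ∈ s.support,
        Finsupp.single (l + m * j) ((((α l : ℤ) : ℂ) * p l) * (((β j : ℤ) : ℂ) * s j)) := by
    rw [dilMul, Finsupp.sum_of_support_subset _ (s := p.support) _ _ (by simp)]
    · refine Finset.sum_congr rfl fun l _ => ?_
      rw [Finsupp.sum_of_support_subset _ (s := s.support) _ _ (by simp)]
      · rfl
      · exact fun j hj => by simpa using right_ne_zero_of_mul (Finsupp.mem_support_iff.1 hj)
    · exact fun j hj => by simpa using right_ne_zero_of_mul (Finsupp.mem_support_iff.1 hj)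
  rw [hdil]
  simp only [dilMul, Finsupp.sum, map_sum, signMul_single]
  refine Finset.sum_congr rfl fun l hl => Finset.sum_congr rfl fun j _ => ?_
  have hl' := abs_le.1 (hd l (Finsupp.mem_support_iff.1 hl))
  have hj : (l + m * j + d) / m = j := by
    rw [show l + m * j + d = (l + d) + m * j by ring, Int.add_mul_ediv_left _ _ (by omega),
      Int.ediv_eq_zero_of_lt (by omega) (by omega), zero_add]
  rw [hj, add_sub_cancel_right]
  congr 1
  push_cast
  ring

/-- Sign multipliers on disjoint frequency ranges can be spliced. -/
theorem exists_signMul_add {N : ℕ} {R Q : ℤ →₀ ℂ} (hR : ∀ k, R k ≠ 0 → |k| ≤ N)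
    (hQ : ∀ k : ℤ, |k| ≤ N → Q k = 0) (α β : ℤ → ℤˣ) :
    ∃ σ : ℤ → ℤˣ, (∀ k : ℤ, |k| ≤ N → σ k = α k) ∧
      signMul σ (R + Q) = signMul α R + signMul β Q := by
  classical
  refine ⟨fun k => if |k| ≤ N then α k else β k, fun k hk => if_pos hk, ?_⟩
  ext k
  by_cases hk : |k| ≤ N
  · simp [hk, hQ k hk]
  · have : R k = 0 := by
      by_contra h
      exact hk (hR k h)
    simp [hk, this]

/-- The coefficients of the complex conjugate of a trigonometric polynomial. -/
noncomputable def conjPoly (p : ℤ →₀ ℂ) : ℤ →₀ ℂ :=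
  p.sum fun k a => Finsupp.single (-k) (starRingEnd ℂ a)

theorem trigEval_conjPoly (p : ℤ →₀ ℂ) (x : Torus) :
    trigEval (conjPoly p) x = starRingEnd ℂ (trigEval p x) := by
  rw [trigEval_apply p]
  simp only [conjPoly, Finsupp.sum, map_sum, ContinuousMap.sum_apply, trigEval_single, map_mul,
    fourier_neg]

theorem conjPoly_apply (p : ℤ →₀ ℂ) (k : ℤ) : conjPoly p k = starRingEnd ℂ (p (-k)) := by
  classical
  simp only [conjPoly, Finsupp.sum, Finsupp.finsetSum_apply, Finsupp.single_apply]
  rw [Finset.sum_eq_single (-k)]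
  · simp
  · exact fun b _ hb => if_neg fun h => hb (by omega)
  · intro h
    simp [Finsupp.notMem_support_iff.1 h]

/-! ### Fejér's lemma on the circle -/

theorem integrable_torus {E : Type*} [NormedAddCommGroup E] (f : C(Torus, E)) :
    Integrable f torusMeasure :=
  f.continuous.integrable_of_hasCompactSupport (HasCompactSupport.of_compactSpace f)

theorem measurePreserving_dilation {m : ℕ} (hm : m ≠ 0) :
    MeasurePreserving (fun x : Torus => m • x) torusMeasure torusMeasure :=
  by simpa only [natCast_zsmul] using
    Measure.measurePreserving_zsmul torusMeasure (n := (m : ℤ)) (by exact_mod_cast hm)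

theorem integral_dilation {E : Type*} [NormedAddCommGroup E] [NormedSpace ℝ E] (V : C(Torus, E))
    {m : ℕ} (hm : m ≠ 0) :
    ∫ x, V (m • x) ∂torusMeasure = ∫ x, V x ∂torusMeasure := by
  have h := measurePreserving_dilation hm
  have := integral_map (μ := torusMeasure) h.measurable.aemeasurable (f := V)
    V.continuous.aestronglyMeasurable
  rw [h.map_eq] at this
  exact this.symm

/-- A dilation `V(mx)` is invariant under translation by `2π/m`, which multiplies `e^{ilx}` by a
number other than `1` when `0 < |l| < m`. -/
theorem integral_fourier_mul_dilation {l : ℤ} (hl : l ≠ 0) {m : ℕ} (hm : |l| < m)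
    (V : C(Torus, ℂ)) : ∫ x, fourier l x * V (m • x) ∂torusMeasure = 0 := by
  have hm0 : (m : ℂ) ≠ 0 := by
    have : m ≠ 0 := by rintro rfl; simp at hm; exact absurd (abs_nonneg l) (not_le.2 hm)
    exact_mod_cast this
  set y : Torus := ((2 * π / m : ℝ) : Torus) with hy
  have hmy : m • y = 0 := by
    rw [hy, ← AddCircle.coe_nsmul, nsmul_eq_mul, mul_div_cancel₀ _ (by exact_mod_cast hm0)]
    exact AddCircle.coe_period _
  have hne : fourier l y ≠ 1 := by
    rw [hy, fourier_coe_apply]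
    intro h
    obtain ⟨n, hn⟩ := Complex.exp_eq_one_iff.1 h
    have hpi : (π : ℂ) ≠ 0 := by exact_mod_cast Real.pi_ne_zero
    have hI := Complex.I_ne_zero
    push_cast at hn
    field_simp at hn
    have hn' : l = m * n := by exact_mod_cast hn
    have : |l| = m * |n| := by rw [hn', abs_mul, Nat.abs_cast]
    have hn0 : n ≠ 0 := by rintro rfl; simp at hn'; exact hl hn'
    have := mul_le_mul_of_nonneg_left (Int.one_le_abs hn0) (Int.natCast_nonneg m)
    omega
  have key := integral_add_right_eq_self (μ := torusMeasure)
    (fun x : Torus => fourier l x * V (m • x)) y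
  have h2 : ∀ x : Torus, fourier l (x + y) * V (m • (x + y)) =
      fourier l y * (fourier l x * V (m • x)) := by
    intro x
    rw [smul_add, hmy, add_zero]
    simp only [fourier_apply, smul_add, AddCircle.toCircle_add, Circle.coe_mul]
    ring
  simp only [h2] at key
  rw [integral_const_mul] at key
  by_contra h
  exact hne (mul_right_cancel₀ h (by rw [key, one_mul]))

theorem integral_fourier_torus {l : ℤ} (hl : l ≠ 0) : ∫ x, fourier l x ∂torusMeasure = 0 := by
  simpa using integral_fourier_mul_dilation hl (m := l.natAbs + 1)
    (by rw [Int.abs_eq_natAbs]; omega) 1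

/-- The mean of a trigonometric polynomial is its constant coefficient. -/
theorem integral_trigEval (p : ℤ →₀ ℂ) : ∫ x, trigEval p x ∂torusMeasure = p 0 := by
  induction p using Finsupp.induction_linear with
  | zero => simp
  | add p q hp hq =>
    simp only [map_add, ContinuousMap.add_apply, Finsupp.add_apply]
    rw [integral_add (integrable_torus _) (integrable_torus _), hp, hq]
  | single k a =>
    simp only [trigEval_single]
    rw [integral_const_mul]
    by_cases hk : k = 0
    · subst hk; simp
    · rw [integral_fourier_torus hk, Finsupp.single_eq_of_ne' hk, mul_zero]

theorem eventually_integral_trigEval_mul_dilation (p : ℤ →₀ ℂ) (V : C(Torus, ℂ)) :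
    ∀ᶠ m : ℕ in atTop, ∫ x, trigEval p x * V (m • x) ∂torusMeasure =
      (∫ x, trigEval p x ∂torusMeasure) * ∫ x, V x ∂torusMeasure := by
  have hint : ∀ (m : ℕ) (f : C(Torus, ℂ)), Integrable (fun x => f x * V (m • x)) torusMeasure :=
    fun m f => integrable_torus
      (⟨fun x => f x * V (m • x), by fun_prop⟩ : C(Torus, ℂ))
  induction p using Finsupp.induction_linear with
  | zero => simp
  | add p q hp hq =>
    filter_upwards [hp, hq] with m h1 h2
    simp only [map_add, ContinuousMap.add_apply, add_mul]
    rw [integral_add (integrable_torus _) (integrable_torus _),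
      integral_add (hint _ _) (hint _ _), h1, h2, add_mul]
  | single k a =>
    filter_upwards [eventually_gt_atTop k.natAbs] with m hm
    simp only [trigEval_single, mul_assoc]
    rw [integral_const_mul, integral_const_mul]
    by_cases hk : k = 0
    · subst hk
      simp [integral_dilation V (by omega : m ≠ 0)]
    · rw [integral_fourier_torus hk, integral_fourier_mul_dilation hk
        (by rw [Int.abs_eq_natAbs]; omega)]
      simp

theorem exists_trigEval_near (f : C(Torus, ℂ)) {η : ℝ} (hη : 0 < η) :
    ∃ p, ‖f - trigEval p‖ < η := by
  have hf : f ∈ closure ((Submodule.span ℂ (range (fourier (T := 2 * π)))) : Set C(Torus, ℂ)) := by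
    rw [← Submodule.topologicalClosure_coe, span_fourier_closure_eq_top]
    trivial
  obtain ⟨g, hg, hfg⟩ := Metric.mem_closure_iff.1 hf η hη
  obtain ⟨p, hp⟩ := (Finsupp.mem_span_range_iff_exists_finsupp).1 hg
  refine ⟨p, ?_⟩
  rw [dist_eq_norm] at hfg
  have : trigEval p = g := by rw [← hp]; rfl
  rwa [this]

/-- Fejér's lemma: a function and a high dilation of another are asymptotically independent. -/
theorem tendsto_integral_mul_dilation (f V : C(Torus, ℂ)) :
    Tendsto (fun m : ℕ => ∫ x, f x * V (m • x) ∂torusMeasure) atTop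
      (𝓝 ((∫ x, f x ∂torusMeasure) * ∫ x, V x ∂torusMeasure)) := by
  rw [Metric.tendsto_atTop']
  intro η hη
  have hC : 0 < 2 * (‖V‖ + 1) := by positivity
  obtain ⟨p, hp⟩ := exists_trigEval_near f (div_pos hη hC)
  have hint : ∀ (m : ℕ) (f : C(Torus, ℂ)), Integrable (fun x => f x * V (m • x)) torusMeasure :=
    fun m f => integrable_torus
      (⟨fun x => f x * V (m • x), by fun_prop⟩ : C(Torus, ℂ))
  have hfp : ∀ x, ‖f x - trigEval p x‖ ≤ η / (2 * (‖V‖ + 1)) := fun x =>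
    ((f - trigEval p).norm_coe_le_norm x).trans hp.le
  have hV : η / (2 * (‖V‖ + 1)) * ‖V‖ < η / 2 := by
    rw [div_mul_eq_mul_div, div_lt_div_iff₀ hC two_pos]
    nlinarith [norm_nonneg V]
  have hc : ∀ g : Torus → ℂ, ∀ C : ℝ, (∀ x, ‖g x‖ ≤ C) → ‖∫ x, g x ∂torusMeasure‖ ≤ C := by
    intro g C hg
    simpa using norm_integral_le_of_norm_le_const (μ := torusMeasure) (Eventually.of_forall hg)
  have e2 : ‖(∫ x, f x ∂torusMeasure) * (∫ x, V x ∂torusMeasure) -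
      (∫ x, trigEval p x ∂torusMeasure) * ∫ x, V x ∂torusMeasure‖ < η / 2 := by
    rw [← sub_mul, ← integral_sub (integrable_torus _) (integrable_torus _), norm_mul]
    refine lt_of_le_of_lt (mul_le_mul (hc _ _ hfp) (hc _ _ V.norm_coe_le_norm) (norm_nonneg _)
      (by positivity)) hV
  obtain ⟨M, hM⟩ := eventually_atTop.1 (eventually_integral_trigEval_mul_dilation p V)
  refine ⟨M, fun m hm => ?_⟩
  have e1 : ‖∫ x, f x * V (m • x) ∂torusMeasure - ∫ x, trigEval p x * V (m • x) ∂torusMeasure‖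
      < η / 2 := by
    rw [← integral_sub (hint _ _) (hint _ _)]
    refine lt_of_le_of_lt (hc _ _ fun x => ?_) hV
    rw [← sub_mul, norm_mul]
    exact mul_le_mul (hfp x) (V.norm_coe_le_norm _) (norm_nonneg _) (by positivity)
  rw [hM m hm.le] at e1
  rw [dist_eq_norm]
  refine lt_of_le_of_lt (norm_sub_le_norm_sub_add_norm_sub _
    ((∫ x, trigEval p x ∂torusMeasure) * ∫ x, V x ∂torusMeasure) _) ?_
  rw [norm_sub_rev] at e2
  linarith

theorem tendsto_integral_mul_dilation_real {f V : Torus → ℝ} (hf : Continuous f)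
    (hV : Continuous V) :
    Tendsto (fun m : ℕ => ∫ x, f x * V (m • x) ∂torusMeasure) atTop
      (𝓝 ((∫ x, f x ∂torusMeasure) * ∫ x, V x ∂torusMeasure)) := by
  have h := tendsto_integral_mul_dilation ⟨fun x => (f x : ℂ), by fun_prop⟩
    ⟨fun x => (V x : ℂ), by fun_prop⟩
  simp only [ContinuousMap.coe_mk, ← Complex.ofReal_mul, integral_complex_ofReal] at h
  simpa [Function.comp_def] using (Complex.continuous_re.tendsto _).comp h

/-! ### Rudin–Shapiro multipliers -/

/-- Beyond the tangent line, a quadratic gain: for `t` of mean zero the mean of `√(1 + t)` is below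
`1` by a fixed multiple of the mean of `t²`. -/
theorem sqrt_one_add_le {t : ℝ} (h1 : -1 ≤ t) (h2 : t ≤ 1) : √(1 + t) ≤ 1 + t / 2 - t ^ 2 / 16 := by
  refine Real.sqrt_le_iff.2 ⟨by nlinarith, ?_⟩
  nlinarith [mul_nonneg (sq_nonneg t) (by linarith : 0 ≤ 1 - t), sq_nonneg (t ^ 2)]

theorem integrable_torus_of_continuous {f : Torus → ℝ} (hf : Continuous f) :
    Integrable f torusMeasure :=
  integrable_torus (⟨f, hf⟩ : C(Torus, ℝ))

theorem integral_re_fourier {k : ℤ} (hk : k ≠ 0) :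
    ∫ x, (fourier k x : ℂ).re ∂torusMeasure = 0 := by
  have h := integral_re (integrable_torus (fourier (T := 2 * π) k))
  rw [integral_fourier_torus hk] at h
  simpa using h

theorem norm_fourier_apply (k : ℤ) (x : Torus) : ‖(fourier k x : ℂ)‖ = 1 := by
  rw [fourier_apply]
  exact Circle.norm_coe _

/-- The mean of `|1 + e^{ix}|` is strictly below its quadratic mean `√2`. -/
theorem integral_norm_one_add_fourier_le :
    ∫ x, ‖1 + (fourier 1 x : ℂ)‖ ∂torusMeasure ≤ √2 * (31 / 32) := by
  have hpt : ∀ x : Torus, ‖1 + (fourier 1 x : ℂ)‖ ≤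
      √2 * (31 / 32) + (√2 / 2) * (fourier 1 x : ℂ).re - √2 / 32 * (fourier 2 x : ℂ).re := by
    intro x
    set z : ℂ := fourier 1 x with hz
    have hn : z.re ^ 2 + z.im ^ 2 = 1 := by
      have : ‖z‖ = 1 := norm_fourier_apply 1 x
      rw [← Complex.sq_norm_sub_sq_im, this]; ring
    have h2 : (fourier 2 x : ℂ) = z * z := by
      rw [show (2 : ℤ) = 1 + 1 by norm_num, fourier_add]
    have h2' : (fourier 2 x : ℂ).re = 2 * z.re ^ 2 - 1 := by
      rw [h2, Complex.mul_re]; nlinarith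
    have hb := abs_le.1 (abs_le_of_sq_le_sq (by nlinarith [sq_nonneg z.im] : z.re ^ 2 ≤ 1 ^ 2)
      zero_le_one)
    have hnorm : ‖1 + z‖ = √2 * √(1 + z.re) := by
      rw [← Real.sqrt_mul zero_le_two, Complex.norm_eq_sqrt_sq_add_sq]
      congr 1
      simp only [Complex.add_re, Complex.one_re, Complex.add_im, Complex.one_im]
      linear_combination hn
    rw [hnorm, h2']
    refine (mul_le_mul_of_nonneg_left (sqrt_one_add_le hb.1 hb.2) (Real.sqrt_nonneg 2)).trans
      (le_of_eq ?_)
    ring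
  have hlin : ∫ x : Torus, (√2 * (31 / 32) + (√2 / 2) * (fourier 1 x : ℂ).re
      - √2 / 32 * (fourier 2 x : ℂ).re) ∂torusMeasure = √2 * (31 / 32) := by
    rw [integral_sub, integral_add, integral_const_mul, integral_const_mul, integral_const_mul,
      integral_re_fourier one_ne_zero, integral_re_fourier two_ne_zero]
    · simp
    all_goals exact integrable_torus_of_continuous (by fun_prop)
  rw [← hlin]
  exact integral_mono (integrable_torus_of_continuous (by fun_prop))
    (integrable_torus_of_continuous (by fun_prop)) hpt

/-- A lacunary Rudin–Shapiro construction: two sign multipliers turn the product `A` of `k` factors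
`1 + e^{imx}`, whose `L¹` norm is exponentially smaller than its `L²` norm, into functions whose
squared moduli add up to a constant. -/
theorem exists_rudinShapiro (k : ℕ) : ∃ (A : ℤ →₀ ℂ) (δ ε : ℤ → ℤˣ),
    (∀ x, ‖trigEval (signMul δ A) x‖ ^ 2 + ‖trigEval (signMul ε A) x‖ ^ 2 = 2 ^ (k + 1)) ∧
    ∫ x, ‖trigEval A x‖ ∂torusMeasure ≤ (√2 * (63 / 64)) ^ k := by
  induction k with
  | zero =>
    refine ⟨Finsupp.single 0 1, 1, 1, fun x => ?_, ?_⟩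
    · simp; norm_num
    · simp
  | succ k ih =>
    obtain ⟨A, δ, ε, hsq, hA⟩ := ih
    obtain ⟨d, hd⟩ := exists_degree_bound A
    set e : ℤ →₀ ℂ := Finsupp.single 1 1 with he
    have he0 : e 0 = 0 := by simp [he]
    have hlim := tendsto_integral_mul_dilation_real (f := fun x => ‖trigEval A x‖)
      (V := fun x => ‖1 + (fourier 1 x : ℂ)‖) (by fun_prop) (by fun_prop)
    have hlt : (∫ x, ‖trigEval A x‖ ∂torusMeasure) * ∫ x, ‖1 + (fourier 1 x : ℂ)‖ ∂torusMeasure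
        < (√2 * (63 / 64)) ^ (k + 1) := by
      have h2 : 0 < √2 := by positivity
      rw [pow_succ]
      refine lt_of_le_of_lt (mul_le_mul hA integral_norm_one_add_fourier_le
        (integral_nonneg fun _ => norm_nonneg _) (by positivity)) ?_
      exact mul_lt_mul_of_pos_left (by nlinarith) (by positivity)
    obtain ⟨m, hm1, ⟨σ, hσ⟩, ⟨τ, hτ⟩, hm2⟩ := ((hlim.eventually_lt_const hlt).and
      ((eventually_exists_signMul_dilMul A e ε 1).and
      ((eventually_exists_signMul_dilMul A e ε (fun _ => -1)).and
      (eventually_dilMul_eq_zero A e he0 d)))).exists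
    obtain ⟨δ', -, hδ'⟩ := exists_signMul_add hd hm2 δ σ
    obtain ⟨ε', -, hε'⟩ := exists_signMul_add hd hm2 δ τ
    refine ⟨A + dilMul m A e, δ', ε', fun x => ?_, ?_⟩
    · have hneg : signMul (fun _ => -1) e = Finsupp.single 1 (-1) := by
        rw [he, signMul_single]; simp
      rw [hδ', hε', hσ, hτ, hneg, signMul_one, he]
      simp only [map_add, ContinuousMap.add_apply, trigEval_dilMul, trigEval_single]
      have hp := parallelogram_law_with_norm ℝ (trigEval (signMul δ A) x)
        (trigEval (signMul ε A) x * fourier 1 (m • x))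
      rw [norm_mul, norm_fourier_apply, mul_one] at hp
      rw [one_mul, neg_one_mul, mul_neg, ← sub_eq_add_neg, pow_succ 2 (k + 1), ← hsq x]
      linear_combination hp
    · refine le_trans (le_of_eq (integral_congr_ae (Eventually.of_forall fun x => ?_))) hm1.le
      simp only [map_add, ContinuousMap.add_apply, trigEval_dilMul, he, trigEval_single, one_mul]
      rw [← norm_mul, mul_add, mul_one]

theorem dilMul_single_one_apply (m : ℕ) (p : ℤ →₀ ℂ) (k : ℤ) :
    dilMul m p (Finsupp.single 1 1) k = p (k - m) := by
  classical
  simp only [dilMul, Finsupp.sum, Finsupp.finsetSum_apply]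
  rw [Finset.sum_eq_single (k - m)]
  · simp
  · intro b _ hb
    simp only [Finsupp.support_single _ (one_ne_zero (α := ℂ)), Finset.sum_singleton]
    exact Finsupp.single_eq_of_ne' fun h => hb (by omega)
  · intro h
    simp [Finsupp.notMem_support_iff.1 h]

theorem signMul_conjPoly {σ : ℤ → ℤˣ} (hσ : ∀ k, σ (-k) = σ k) (q : ℤ →₀ ℂ) :
    signMul σ (conjPoly q) = conjPoly (signMul σ q) := by
  ext k
  simp [conjPoly_apply, hσ]

/-- The real part of a modulation `θ e^{imx} A(x)`: sign multipliers carry over from `A`, since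
the modulation moves the spectrum into the positive half line. -/
theorem eventually_exists_real_part (A : ℤ →₀ ℂ) (δ : ℤ → ℤˣ) (θ : ℂ) (hθ : ‖θ‖ = 1) :
    ∀ᶠ m : ℕ in atTop, ∃ (s : ℤ →₀ ℂ) (σ : ℤ → ℤˣ), s 0 = 0 ∧
      (∀ x, ‖trigEval s x‖ ≤ ‖trigEval A x‖) ∧
      ∀ x, trigEval (signMul σ s) x =
        ((θ * (trigEval (signMul δ A) x * fourier 1 (m • x))).re : ℂ) := by
  obtain ⟨d, hd⟩ := exists_degree_bound A
  filter_upwards [eventually_gt_atTop d] with m hm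
  have hA0 : ∀ k : ℤ, k ≤ 0 → A (k - m) = 0 := by
    intro k hk
    by_contra h
    have := hd _ h
    rw [abs_le] at this
    omega
  set q : ℤ →₀ ℂ := θ • dilMul m A (Finsupp.single 1 1) with hq
  -- The polynomial `q` lives on positive frequencies and its conjugate on negative ones; an even
  -- choice of signs acts on both in the same way.
  set σ : ℤ → ℤˣ := fun k => δ (|k| - m) with hσ
  have hσq : signMul σ q = θ • dilMul m (signMul δ A) (Finsupp.single 1 1) := by
    ext k
    simp only [hq, hσ, signMul_apply, Finsupp.smul_apply, dilMul_single_one_apply, smul_eq_mul]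
    rcases le_or_gt k 0 with hk | hk
    · simp [hA0 k hk]
    · rw [abs_of_pos hk]; ring
  have hev : ∀ (B : ℤ →₀ ℂ) (x : Torus),
      trigEval ((2⁻¹ : ℂ) • (B + conjPoly B)) x = ((trigEval B x).re : ℂ) := by
    intro B x
    simp only [map_smul, map_add, ContinuousMap.smul_apply, ContinuousMap.add_apply,
      trigEval_conjPoly, smul_eq_mul]
    rw [Complex.re_eq_add_conj]
    ring
  refine ⟨(2⁻¹ : ℂ) • (q + conjPoly q), σ, ?_, fun x => ?_, fun x => ?_⟩
  · have hq0 : q 0 = 0 := by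
      rw [hq, Finsupp.smul_apply, dilMul_single_one_apply, hA0 0 le_rfl, smul_zero]
    simp [conjPoly_apply, hq0]
  · rw [hev, Complex.norm_real]
    refine (Complex.abs_re_le_norm _).trans (le_of_eq ?_)
    simp only [hq, map_smul, ContinuousMap.smul_apply, trigEval_dilMul, trigEval_single, smul_eq_mul,
      norm_mul, hθ, norm_fourier_apply, mul_one, one_mul]
  · rw [map_smul, map_add, signMul_conjPoly (fun k => by simp [hσ]), hev, hσq]
    simp only [map_smul, ContinuousMap.smul_apply, trigEval_dilMul, trigEval_single, smul_eq_mul,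
      one_mul]

/-- A trigonometric polynomial of small `L¹` norm which a sign multiplier turns into a real function
bounded by `1` that is not small in `L²`. -/
theorem exists_small_signMul_large {η : ℝ} (hη : 0 < η) :
    ∃ (s : ℤ →₀ ℂ) (δ : ℤ → ℤˣ) (v : Torus → ℝ), Continuous v ∧ s 0 = 0 ∧
      ∫ x, ‖trigEval s x‖ ∂torusMeasure < η ∧ (∀ x, trigEval (signMul δ s) x = (v x : ℂ)) ∧
      (∀ x, |v x| ≤ 1) ∧ 1 / 4 ≤ ∫ x, v x ^ 2 ∂torusMeasure := by
  obtain ⟨k, hk⟩ := exists_pow_lt_of_lt_one hη (by norm_num : (63 / 64 : ℝ) < 1)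
  obtain ⟨A, δ, ε, hsq, hA⟩ := exists_rudinShapiro k
  set c : ℝ := (√2 ^ (k + 1))⁻¹ with hc
  have hc0 : 0 < c := by positivity
  have hc2 : c ^ 2 * 2 ^ (k + 1) = 1 := by
    rw [hc, inv_pow, ← pow_mul, mul_comm (k + 1) 2, pow_mul, Real.sq_sqrt zero_le_two]
    exact inv_mul_cancel₀ (by positivity)
  have hnI : ‖-Complex.I‖ = 1 := by simp
  obtain ⟨m, h1, h2, h3, h4⟩ := ((eventually_exists_real_part A δ 1 norm_one).and
    ((eventually_exists_real_part A δ (-Complex.I) hnI).and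
    ((eventually_exists_real_part A ε 1 norm_one).and
    (eventually_exists_real_part A ε (-Complex.I) hnI)))).exists
  set V : (ℤ → ℤˣ) → ℂ → Torus → ℝ := fun δ θ x =>
    c * (θ * (trigEval (signMul δ A) x * fourier 1 (m • x))).re with hV
  have hVc : ∀ δ θ, Continuous (V δ θ) := fun δ θ => by simp only [hV]; fun_prop
  have key : ∀ δ' θ, (∀ x, ‖trigEval (signMul δ' A) x‖ ^ 2 ≤ 2 ^ (k + 1)) → ‖θ‖ = 1 →
      (∃ (s : ℤ →₀ ℂ) (σ : ℤ → ℤˣ), s 0 = 0 ∧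
        (∀ x, ‖trigEval s x‖ ≤ ‖trigEval A x‖) ∧
        ∀ x, trigEval (signMul σ s) x =
          ((θ * (trigEval (signMul δ' A) x * fourier 1 (m • x))).re : ℂ)) →
      1 / 4 ≤ ∫ x, V δ' θ x ^ 2 ∂torusMeasure →
      ∃ (s : ℤ →₀ ℂ) (δ : ℤ → ℤˣ) (v : Torus → ℝ), Continuous v ∧ s 0 = 0 ∧
        ∫ x, ‖trigEval s x‖ ∂torusMeasure < η ∧ (∀ x, trigEval (signMul δ s) x = (v x : ℂ)) ∧
        (∀ x, |v x| ≤ 1) ∧ 1 / 4 ≤ ∫ x, v x ^ 2 ∂torusMeasure := by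
    rintro δ' θ hδ' hθ ⟨s, σ, hs0, hsA, hsσ⟩ hint
    refine ⟨(c : ℂ) • s, σ, V δ' θ, hVc _ _, by simp [hs0], ?_, fun x => ?_, fun x => ?_, hint⟩
    · have hle : ∫ x, ‖trigEval ((c : ℂ) • s) x‖ ∂torusMeasure ≤
          ∫ x, c * ‖trigEval A x‖ ∂torusMeasure := by
        refine integral_mono (integrable_torus _).norm ((integrable_torus _).norm.const_mul c)
          fun x => ?_
        simp only [map_smul, ContinuousMap.smul_apply, norm_smul, Complex.norm_real,
          Real.norm_of_nonneg hc0.le]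
        exact mul_le_mul_of_nonneg_left (hsA x) hc0.le
      refine hle.trans_lt ?_
      rw [integral_const_mul]
      refine lt_of_le_of_lt ((mul_le_mul_of_nonneg_left hA hc0.le).trans ?_) hk
      rw [mul_pow, hc, pow_succ, ← mul_assoc]
      refine mul_le_of_le_one_left (by positivity) ?_
      rw [mul_inv, mul_comm, ← mul_assoc, mul_inv_cancel₀ (by positivity), one_mul]
      refine inv_le_one_of_one_le₀ (Real.one_le_sqrt.2 one_le_two)
    · rw [map_smul, map_smul, ContinuousMap.smul_apply, hsσ, hV]
      simp
    · refine abs_le_of_sq_le_sq ?_ zero_le_one |> fun h => by simpa using h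
      have hre : (θ * (trigEval (signMul δ' A) x * fourier 1 (m • x))).re ^ 2 ≤ 2 ^ (k + 1) := by
        refine le_trans ?_ (hδ' x)
        rw [sq_le_sq, abs_norm]
        refine (Complex.abs_re_le_norm _).trans (le_of_eq ?_)
        rw [norm_mul, norm_mul, hθ, norm_fourier_apply, one_mul, mul_one]
      calc V δ' θ x ^ 2 = c ^ 2 * (θ * (trigEval (signMul δ' A) x * fourier 1 (m • x))).re ^ 2 := by
            rw [hV]; ring
        _ ≤ c ^ 2 * 2 ^ (k + 1) := by gcongr
        _ = 1 ^ 2 := by rw [hc2, one_pow]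
  have hδb : ∀ x, ‖trigEval (signMul δ A) x‖ ^ 2 ≤ 2 ^ (k + 1) := fun x => by
    rw [← hsq x]; exact le_add_of_nonneg_right (sq_nonneg _)
  have hεb : ∀ x, ‖trigEval (signMul ε A) x‖ ^ 2 ≤ 2 ^ (k + 1) := fun x => by
    rw [← hsq x]; exact le_add_of_nonneg_left (sq_nonneg _)
  by_contra hcon
  have l1 := not_le.1 fun h => hcon (key _ _ hδb norm_one h1 h)
  have l2 := not_le.1 fun h => hcon (key _ _ hδb hnI h2 h)
  have l3 := not_le.1 fun h => hcon (key _ _ hεb norm_one h3 h)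
  have l4 := not_le.1 fun h => hcon (key _ _ hεb hnI h4 h)
  -- The four squares add up to `1`, so their integrals cannot all be below `1 / 4`.
  have hsum : ∀ x, V δ 1 x ^ 2 + V δ (-Complex.I) x ^ 2 + (V ε 1 x ^ 2 + V ε (-Complex.I) x ^ 2)
      = 1 := by
    intro x
    have h : ∀ δ', V δ' 1 x ^ 2 + V δ' (-Complex.I) x ^ 2 =
        c ^ 2 * ‖trigEval (signMul δ' A) x‖ ^ 2 := by
      intro δ'
      have hn : ‖trigEval (signMul δ' A) x‖ =
          ‖trigEval (signMul δ' A) x * fourier 1 (m • x)‖ := by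
        rw [norm_mul, norm_fourier_apply, mul_one]
      rw [hn, Complex.sq_norm, Complex.normSq_apply, hV]
      simp only [one_mul, neg_mul, Complex.neg_re, Complex.I_mul_re, neg_neg]
      ring
    rw [h, h, ← mul_add, hsq, hc2]
  have hi : ∀ δ θ, Integrable (fun x => V δ θ x ^ 2) torusMeasure := fun δ θ =>
    integrable_torus_of_continuous ((hVc δ θ).pow 2)
  have hone : ∫ x, (V δ 1 x ^ 2 + V δ (-Complex.I) x ^ 2 +
      (V ε 1 x ^ 2 + V ε (-Complex.I) x ^ 2)) ∂torusMeasure = 1 := by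
    simp [hsum]
  rw [integral_add, integral_add (hi _ _) (hi _ _), integral_add (hi _ _) (hi _ _)] at hone
  · linarith
  · exact (hi _ _).add (hi _ _)
  · exact (hi _ _).add (hi _ _)

/-! ### Riesz products and approximation on the circle -/

theorem integral_norm_trigEval_dilation (p : ℤ →₀ ℂ) {m : ℕ} (hm : m ≠ 0) :
    ∫ x, ‖trigEval p (m • x)‖ ∂torusMeasure = ∫ x, ‖trigEval p x‖ ∂torusMeasure :=
  integral_dilation (⟨fun x => ‖trigEval p x‖, by fun_prop⟩ : C(Torus, ℝ)) hm

/-- Lacunary products `Π = ∏ (1 + t(mᵢx))` with `t` the sign transform of a polynomial `s` of small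
`L¹` norm. The difference `1 - Π` is the sign transform of a polynomial `R` whose `L¹` norm is
controlled by that of `s`, while the mean of `√Π` decays exponentially. -/
theorem exists_signed_rieszProduct (s : ℤ →₀ ℂ) (δ : ℤ → ℤˣ) (v : Torus → ℝ) (hv : Continuous v)
    (hs0 : s 0 = 0) (hsv : ∀ x, trigEval (signMul δ s) x = (v x : ℂ)) (hv1 : ∀ x, |v x| ≤ 1)
    (hv2 : 1 / 4 ≤ ∫ x, v x ^ 2 ∂torusMeasure) (K : ℕ) :
    ∃ (R P : ℤ →₀ ℂ) (σ : ℤ → ℤˣ) (w : Torus → ℝ), Continuous w ∧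
      signMul σ R = Finsupp.single 0 1 - P ∧ R 0 = 0 ∧ (∀ x, trigEval P x = (w x : ℂ)) ∧
      (∀ x, 0 ≤ w x) ∧ (∀ x, w x ≤ 2 ^ K) ∧ ∫ x, √(w x) ∂torusMeasure ≤ (127 / 128) ^ K ∧
      ∫ x, ‖trigEval R x‖ ∂torusMeasure ≤ (2 ^ K - 1) * ∫ x, ‖trigEval s x‖ ∂torusMeasure := by
  have hvb := fun x => abs_le.1 (hv1 x)
  -- `1 - (1 / 4) / 16 = 63 / 64`; the rate `127 / 128` leaves room for the error in Fejér's lemma.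
  have hmean : ∫ x, √(1 + v x) ∂torusMeasure ≤ 63 / 64 := by
    have hv0 : ∫ x, v x ∂torusMeasure = 0 := by
      have h := integral_trigEval (signMul δ s)
      simp only [hsv, integral_complex_ofReal, signMul_apply, hs0, mul_zero] at h
      exact_mod_cast h
    have h1 : ∫ x, √(1 + v x) ∂torusMeasure ≤
        ∫ x, (1 + v x / 2 - v x ^ 2 / 16) ∂torusMeasure :=
      integral_mono (integrable_torus_of_continuous (by fun_prop))
        (integrable_torus_of_continuous (by fun_prop))
        fun x => sqrt_one_add_le (hvb x).1 (hvb x).2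
    have h2 : ∫ x, (1 + v x / 2 - v x ^ 2 / 16) ∂torusMeasure =
        1 - (∫ x, v x ^ 2 ∂torusMeasure) / 16 := by
      rw [integral_sub, integral_add, integral_div, integral_div, hv0]
      · simp
      all_goals exact integrable_torus_of_continuous (by fun_prop)
    linarith
  induction K with
  | zero =>
    refine ⟨0, Finsupp.single 0 1, 1, fun _ => 1, by fun_prop, by simp, by simp, by simp, by simp,
      by simp, by simp, by simp⟩
  | succ K ih =>
    obtain ⟨R, P, σ, w, hw, hσ, hR0, hP, hw0, hwK, hsqrt, hRs⟩ := ih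
    obtain ⟨d, hd⟩ := exists_degree_bound R
    have hlim := tendsto_integral_mul_dilation_real (f := fun x => √(w x))
      (V := fun x => √(1 + v x)) (by fun_prop) (by fun_prop)
    have hlt : (∫ x, √(w x) ∂torusMeasure) * ∫ x, √(1 + v x) ∂torusMeasure
        < (127 / 128) ^ (K + 1) := by
      rw [pow_succ]
      refine lt_of_le_of_lt (mul_le_mul hsqrt hmean
        (integral_nonneg fun _ => Real.sqrt_nonneg _) (by positivity)) ?_
      exact mul_lt_mul_of_pos_left (by norm_num) (by positivity)
    obtain ⟨m, hm1, ⟨τ, hτ⟩, hm2, hm0⟩ := ((hlim.eventually_lt_const hlt).and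
      ((eventually_exists_signMul_dilMul (-P) s 1 δ).and
      ((eventually_dilMul_eq_zero (-P) s hs0 d).and (eventually_ne_atTop 0)))).exists
    obtain ⟨σ', -, hσ'⟩ := exists_signMul_add hd hm2 σ τ
    have hneg : ∀ q, dilMul m (-P) q = -dilMul m P q := by
      intro q
      rw [dilMul, Finsupp.sum_neg_index (by simp), dilMul, ← Finsupp.sum_neg]
      refine Finsupp.sum_congr fun l _ => ?_
      rw [← Finsupp.sum_neg]
      exact Finsupp.sum_congr fun j _ => by rw [neg_mul, Finsupp.single_neg]
    refine ⟨R + dilMul m (-P) s, P + dilMul m P (signMul δ s), σ',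
      fun x => w x * (1 + v (m • x)), by fun_prop, ?_, ?_, fun x => ?_, fun x => ?_, fun x => ?_,
      ?_, ?_⟩
    · rw [hσ', hσ, hτ, signMul_one, hneg]
      abel
    · rw [Finsupp.add_apply, hR0, hm2 0 (by simp), add_zero]
    · simp only [map_add, ContinuousMap.add_apply, trigEval_dilMul, hP, hsv]
      push_cast
      ring
    · exact mul_nonneg (hw0 x) (by linarith [(hvb (m • x)).1])
    · rw [pow_succ]
      exact mul_le_mul (hwK x) (by linarith [(hvb (m • x)).2]) (by linarith [(hvb (m • x)).1])
        (by positivity)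
    · refine le_trans (le_of_eq (integral_congr_ae (Eventually.of_forall fun x => ?_))) hm1.le
      exact Real.sqrt_mul (hw0 x) _
    · have hle : ∫ x, ‖trigEval (R + dilMul m (-P) s) x‖ ∂torusMeasure ≤
          ∫ x, (‖trigEval R x‖ + 2 ^ K * ‖trigEval s (m • x)‖) ∂torusMeasure := by
        refine integral_mono (integrable_torus_of_continuous (by fun_prop))
          (integrable_torus_of_continuous (by fun_prop)) fun x => ?_
        simp only [map_add, ContinuousMap.add_apply, trigEval_dilMul, map_neg,
          ContinuousMap.neg_apply, hP]
        refine (norm_add_le _ _).trans (add_le_add_right ?_ _)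
        rw [norm_mul, norm_neg, Complex.norm_real, Real.norm_of_nonneg (hw0 x)]
        exact mul_le_mul_of_nonneg_right (hwK x) (norm_nonneg _)
      refine hle.trans ?_
      rw [integral_add, integral_const_mul,
        integral_norm_trigEval_dilation s hm0]
      · rw [pow_succ]
        linarith
      all_goals exact integrable_torus_of_continuous (by fun_prop)

/-- A trigonometric polynomial of mean zero and small `L¹` norm which a sign multiplier brings
close to the constant `1` off a small set, at bounded cost in `L¹`. -/
theorem exists_small_signMul_near_one {η : ℝ} (hη : 0 < η) :
    ∃ (R : ℤ →₀ ℂ) (σ : ℤ → ℤˣ) (E : Set Torus), R 0 = 0 ∧ MeasurableSet E ∧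
      torusMeasure.real Eᶜ < η ∧ ∫ x, ‖trigEval R x‖ ∂torusMeasure < η ∧
      ∫ x, ‖trigEval (signMul σ R) x‖ ∂torusMeasure ≤ 2 ∧
      ∀ x ∈ E, ‖trigEval (signMul σ R) x - 1‖ ≤ η := by
  have hη' : 0 < √η := Real.sqrt_pos.2 hη
  -- `K` is fixed before `s`: the decay rate `127 / 128` of `∫ √Π` is the same for all `s`, so the
  -- `L¹` norm of `s` can afterwards be made small compared with `2 ^ K`.
  obtain ⟨K, hK⟩ := exists_pow_lt_of_lt_one (mul_pos hη hη') (by norm_num : (127 / 128 : ℝ) < 1)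
  obtain ⟨s, δ, v, hv, hs0, hs, hsv, hv1, hv2⟩ :=
    exists_small_signMul_large (div_pos hη (by positivity : (0 : ℝ) < 2 ^ K))
  obtain ⟨R, P, σ, w, hw, hσ, hR0, hP, hw0, hwK, hsqrt, hRs⟩ :=
    exists_signed_rieszProduct s δ v hv hs0 hsv hv1 hv2 K
  have hev : ∀ x, trigEval (signMul σ R) x = 1 - (w x : ℂ) := fun x => by
    rw [hσ, map_sub, ContinuousMap.sub_apply, hP, trigEval_single, fourier_zero, one_mul]
  have hwint := integrable_torus_of_continuous hw
  have hw1 : ∫ x, w x ∂torusMeasure = 1 := by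
    have h := integral_trigEval (signMul σ R)
    simp only [signMul_apply, hR0, mul_zero] at h
    have h2 : ∀ x, trigEval (signMul σ R) x = ((1 - w x : ℝ) : ℂ) := fun x => by
      rw [hev]; push_cast; rfl
    simp only [h2, integral_complex_ofReal] at h
    have h3 : ∫ x, (1 - w x) ∂torusMeasure = 0 := by exact_mod_cast h
    rw [integral_sub (integrable_const _) hwint] at h3
    simp at h3
    linarith
  refine ⟨R, σ, {x | √(w x) < √η}, hR0, (measurableSet_lt (by fun_prop) (by fun_prop)), ?_, ?_, ?_,
    fun x hx => ?_⟩
  · have hm := mul_meas_ge_le_integral_of_nonneg (μ := torusMeasure) (f := fun x => √(w x))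
      (Eventually.of_forall fun x => Real.sqrt_nonneg _)
      (integrable_torus_of_continuous (by fun_prop)) (√η)
    have hset : {x : Torus | √(w x) < √η}ᶜ = {x | √η ≤ √(w x)} := by
      ext x; simp
    rw [hset]
    have := (hm.trans hsqrt).trans_lt hK
    rw [mul_comm η] at this
    exact lt_of_mul_lt_mul_left this hη'.le
  · refine hRs.trans_lt ?_
    have hs' := (lt_div_iff₀ (by positivity : (0 : ℝ) < 2 ^ K)).1 hs
    have hnn : 0 ≤ ∫ x, ‖trigEval s x‖ ∂torusMeasure := integral_nonneg fun _ => norm_nonneg _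
    nlinarith
  · have hle : ∫ x, ‖trigEval (signMul σ R) x‖ ∂torusMeasure ≤
        ∫ x, (1 + w x) ∂torusMeasure := by
      refine integral_mono (integrable_torus_of_continuous (by fun_prop))
        (integrable_torus_of_continuous (by fun_prop)) fun x => ?_
      simp only [hev]
      refine (norm_sub_le _ _).trans (le_of_eq ?_)
      rw [norm_one, Complex.norm_real, Real.norm_of_nonneg (hw0 x)]
    refine hle.trans (le_of_eq ?_)
    rw [integral_add (integrable_const _) hwint, hw1]
    simp; norm_num
  · rw [hev, sub_right_comm, sub_self, zero_sub, norm_neg, Complex.norm_real,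
      Real.norm_of_nonneg (hw0 x)]
    exact ((Real.sqrt_lt_sqrt_iff (hw0 x)).1 hx).le

theorem measureReal_preimage_dilation {m : ℕ} (hm : m ≠ 0) {E : Set Torus} (hE : MeasurableSet E) :
    torusMeasure.real ((fun x : Torus => m • x) ⁻¹' E) = torusMeasure.real E :=
  (measurePreserving_dilation hm).measureReal_preimage hE.nullMeasurableSet

/-- Every trigonometric polynomial agrees, up to a small error off a small set, with one of
arbitrarily high spectrum and comparable `L¹` norm. -/
theorem exists_high_spectrum_near (p : ℤ →₀ ℂ) (N : ℕ) {η : ℝ} (hη : 0 < η) :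
    ∃ (Q : ℤ →₀ ℂ) (E : Set Torus), MeasurableSet E ∧ torusMeasure.real Eᶜ < η ∧
      (∀ k : ℤ, |k| ≤ N → Q k = 0) ∧
      ∫ x, ‖trigEval Q x‖ ∂torusMeasure ≤ 2 * ∫ x, ‖trigEval p x‖ ∂torusMeasure + η ∧
      ∀ x ∈ E, ‖trigEval Q x - trigEval p x‖ ≤ η := by
  set C : ℝ := ‖trigEval p‖ + 1 with hC
  have hC1 : 1 ≤ C := by simp [hC]
  have hη1 : 0 < η / C := by positivity
  have hη2 : η / C ≤ η := div_le_self hη.le hC1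
  obtain ⟨R, σ, E, hR0, hE, hEη, -, hR2, hRE⟩ := exists_small_signMul_near_one hη1
  have hlim := tendsto_integral_mul_dilation_real (f := fun x => ‖trigEval p x‖)
    (V := fun x => ‖trigEval (signMul σ R) x‖) (by fun_prop) (by fun_prop)
  have hlt : (∫ x, ‖trigEval p x‖ ∂torusMeasure) * ∫ x, ‖trigEval (signMul σ R) x‖ ∂torusMeasure
      < 2 * ∫ x, ‖trigEval p x‖ ∂torusMeasure + η := by
    have hnn : 0 ≤ ∫ x, ‖trigEval p x‖ ∂torusMeasure := integral_nonneg fun _ => norm_nonneg _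
    nlinarith
  obtain ⟨m, hm1, hm2, hm0⟩ := ((hlim.eventually_lt_const hlt).and
    ((eventually_dilMul_eq_zero p (signMul σ R) (by simp [hR0]) N).and
      (eventually_ne_atTop 0))).exists
  refine ⟨dilMul m p (signMul σ R), (fun x : Torus => m • x) ⁻¹' E,
    hE.preimage (measurePreserving_dilation hm0).measurable, ?_, hm2, ?_, fun x hx => ?_⟩
  · rw [← preimage_compl, measureReal_preimage_dilation hm0 hE.compl]
    exact hEη.trans_le hη2
  · simp only [trigEval_dilMul, norm_mul]
    exact hm1.le
  · rw [trigEval_dilMul, ← mul_sub_one, norm_mul]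
    calc _ ≤ C * (η / C) := mul_le_mul (((trigEval p).norm_coe_le_norm x).trans (by simp [hC]))
          (hRE _ hx) (norm_nonneg _) (by positivity)
      _ = η := mul_div_cancel₀ _ (by positivity)

/-- Every trigonometric polynomial is, up to a small error off a small set, a sign transform of one
with arbitrarily high spectrum and arbitrarily small `L¹` norm. -/
theorem exists_small_signMul_near (p : ℤ →₀ ℂ) (N : ℕ) {η : ℝ} (hη : 0 < η) :
    ∃ (Q : ℤ →₀ ℂ) (σ : ℤ → ℤˣ) (E : Set Torus), MeasurableSet E ∧ torusMeasure.real Eᶜ < η ∧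
      (∀ k : ℤ, |k| ≤ N → Q k = 0) ∧ ∫ x, ‖trigEval Q x‖ ∂torusMeasure ≤ η ∧
      ∀ x ∈ E, ‖trigEval (signMul σ Q) x - trigEval p x‖ ≤ η := by
  set C : ℝ := ‖trigEval p‖ + 1 with hC
  have hC1 : 1 ≤ C := by simp [hC]
  have hη1 : 0 < η / C := by positivity
  have hη2 : η / C ≤ η := div_le_self hη.le hC1
  have hpC : ∀ x, ‖trigEval p x‖ ≤ C := fun x =>
    ((trigEval p).norm_coe_le_norm x).trans (by simp [hC])
  obtain ⟨R, σ, E, hR0, hE, hEη, hRη, -, hRE⟩ := exists_small_signMul_near_one hη1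
  obtain ⟨m, ⟨τ, hτ⟩, hm2, hm0⟩ := ((eventually_exists_signMul_dilMul p R 1 σ).and
    ((eventually_dilMul_eq_zero p R hR0 N).and (eventually_ne_atTop 0))).exists
  refine ⟨dilMul m p R, τ, (fun x : Torus => m • x) ⁻¹' E,
    hE.preimage (measurePreserving_dilation hm0).measurable, ?_, hm2, ?_, fun x hx => ?_⟩
  · rw [← preimage_compl, measureReal_preimage_dilation hm0 hE.compl]
    exact hEη.trans_le hη2
  · have hle : ∫ x, ‖trigEval (dilMul m p R) x‖ ∂torusMeasure ≤
        ∫ x, C * ‖trigEval R (m • x)‖ ∂torusMeasure := by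
      refine integral_mono (integrable_torus_of_continuous (by fun_prop))
        (integrable_torus_of_continuous (by fun_prop)) fun x => ?_
      simp only [trigEval_dilMul, norm_mul]
      exact mul_le_mul_of_nonneg_right (hpC x) (norm_nonneg _)
    refine hle.trans ?_
    rw [integral_const_mul,
      integral_norm_trigEval_dilation R hm0]
    exact (mul_le_mul_of_nonneg_left hRη.le (by positivity)).trans
      (mul_div_cancel₀ _ (by positivity)).le
  · rw [hτ, signMul_one, trigEval_dilMul, ← mul_sub_one, norm_mul]
    calc _ ≤ C * (η / C) := mul_le_mul (hpC x) (hRE _ hx) (norm_nonneg _) (by positivity)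
      _ = η := mul_div_cancel₀ _ (by positivity)

/-! ### From the circle to the interval -/

/-- The trigonometric polynomial `∑ p k e^{ikx}` as a function on the real line. -/
noncomputable def trigFun (p : ℤ →₀ ℂ) (x : ℝ) : ℂ := trigEval p (x : Torus)

theorem continuous_trigFun (p : ℤ →₀ ℂ) : Continuous (trigFun p) :=
  (trigEval p).continuous.comp (AddCircle.continuous_mk' _)

theorem fourier_coe_torus (k : ℤ) (x : ℝ) :
    (fourier k (x : Torus) : ℂ) = Complex.exp (Complex.I * k * (x : ℂ)) := by
  rw [fourier_coe_apply]
  congr 1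
  have hpi : (π : ℂ) ≠ 0 := by exact_mod_cast Real.pi_ne_zero
  push_cast
  field_simp

theorem trigFun_apply (p : ℤ →₀ ℂ) (x : ℝ) :
    trigFun p x = ∑ k ∈ p.support, p k * Complex.exp (Complex.I * k * (x : ℂ)) := by
  rw [trigFun, trigEval_apply]
  simp only [fourier_coe_torus, Finsupp.sum]

theorem trigFun_add (p q : ℤ →₀ ℂ) (x : ℝ) : trigFun (p + q) x = trigFun p x + trigFun q x := by
  simp [trigFun]

theorem integrable_volPi {f : ℝ → ℂ} (hf : Continuous f) : Integrable f volPi :=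
  hf.continuousOn.integrableOn_compact isCompact_Icc

theorem integrable_trigFun (p : ℤ →₀ ℂ) : Integrable (trigFun p) volPi :=
  integrable_volPi (continuous_trigFun p)

theorem measurePreserving_coe_torus :
    MeasurePreserving ((↑) : ℝ → Torus) volPi (volume : Measure Torus) := by
  have h := AddCircle.measurePreserving_mk (2 * π) (-π)
  rwa [show -π + 2 * π = π by ring, Measure.restrict_congr_set Ioc_ae_eq_Icc] at h

theorem integral_coe_torus {f : Torus → ℝ} (hf : Continuous f) :
    ∫ x : ℝ, f (x : Torus) ∂volPi = 2 * π * ∫ x, f x ∂torusMeasure := by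
  have h := measurePreserving_coe_torus
  have h2 := integral_map (μ := volPi) h.measurable.aemeasurable (f := f)
    hf.aestronglyMeasurable
  rw [h.map_eq] at h2
  rw [← h2, integral_haarAddCircle, smul_eq_mul, mul_inv_cancel_left₀ Real.two_pi_pos.ne']

theorem volPi_preimage_coe {E : Set Torus} (hE : MeasurableSet E) :
    volPi (((↑) : ℝ → Torus) ⁻¹' E) = ENNReal.ofReal (2 * π * torusMeasure.real E) := by
  rw [measurePreserving_coe_torus.measure_preimage hE.nullMeasurableSet,
    volume_eq_smul_haarAddCircle, Measure.smul_apply, smul_eq_mul,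
    ENNReal.ofReal_mul Real.two_pi_pos.le, measureReal_def, ENNReal.ofReal_toReal (measure_ne_top _ _)]

/-- Trigonometric polynomials are dense in `L¹([-π, π])`. -/
theorem exists_trigFun_near {f : ℝ → ℂ} (hf : Integrable f volPi) {η : ℝ} (hη : 0 < η) :
    ∃ p, ∫ x, ‖trigFun p x - f x‖ ∂volPi ≤ η := by
  have hpi : -π + 2 * π = π := by ring
  set F : Torus → ℂ := AddCircle.liftIoc (2 * π) (-π) f with hF
  have hFm : MemLp F 1 (volume : Measure Torus) := by
    refine MemLp.memLp_liftIoc ?_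
    rw [hpi, Measure.restrict_congr_set Ioc_ae_eq_Icc]
    exact memLp_one_iff_integrable.2 hf
  have hFf : ∀ᵐ x : ℝ ∂volPi, F (x : Torus) = f x := by
    rw [volPi, ← Measure.restrict_congr_set Ioc_ae_eq_Icc]
    refine (ae_restrict_iff' measurableSet_Ioc).2 (Eventually.of_forall fun x hx => ?_)
    exact AddCircle.liftIoc_coe_apply (by rwa [hpi])
  have hFi := memLp_one_iff_integrable.1 hFm
  obtain ⟨g, hg, hgi⟩ := hFi.exists_boundedContinuous_integral_sub_le (half_pos hη)
  have hη2 : 0 < η / (4 * π) := by positivity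
  obtain ⟨p, hp⟩ := exists_trigEval_near g.toContinuousMap hη2
  have hpg : ∀ y : Torus, ‖trigEval p y - g y‖ ≤ η / (4 * π) := fun y => by
    rw [norm_sub_rev]
    exact ((g.toContinuousMap - trigEval p).norm_coe_le_norm y).trans hp.le
  refine ⟨p, ?_⟩
  have hmp := measurePreserving_coe_torus
  have hsub : AEStronglyMeasurable (fun y => ‖trigEval p y - F y‖) (volume : Measure Torus) :=
    ((trigEval p).continuous.aestronglyMeasurable.sub hFi.1).norm
  have e1 : ∫ x, ‖trigFun p x - f x‖ ∂volPi = ∫ y : Torus, ‖trigEval p y - F y‖ := by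
    have h2 := integral_map (μ := volPi) hmp.measurable.aemeasurable
      (f := fun y => ‖trigEval p y - F y‖) (by rw [hmp.map_eq]; exact hsub)
    rw [hmp.map_eq] at h2
    rw [h2]
    refine integral_congr_ae (hFf.mono fun x hx => ?_)
    simp only [hx, trigFun]
  have hpi' : Integrable (trigEval p) (volume : Measure Torus) :=
    (trigEval p).continuous.integrable_of_hasCompactSupport (HasCompactSupport.of_compactSpace _)
  have e2 : ∫ y : Torus, ‖trigEval p y - F y‖ ≤
      ∫ y : Torus, (η / (4 * π) + ‖F y - g y‖) := by
    refine integral_mono (hpi'.sub hFi).norm ((integrable_const _).add (hFi.sub hgi).norm)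
      fun y => ?_
    rw [norm_sub_rev (F y)]
    exact (norm_sub_le_norm_sub_add_norm_sub _ (g y) _).trans (add_le_add_left (hpg y) _)
  rw [e1]
  refine e2.trans ?_
  rw [integral_add (integrable_const _) (f := fun _ => η / (4 * π)) (g := fun y => ‖F y - g y‖)
    (hFi.sub hgi).norm]
  have e3 : ∫ _ : Torus, η / (4 * π) = η / 2 := by
    rw [integral_const, measureReal_def, AddCircle.measure_univ,
      ENNReal.toReal_ofReal Real.two_pi_pos.le, smul_eq_mul]
    field_simp
    norm_num
  rw [e3]
  linarith

theorem integral_norm_sub_le {μ : Measure ℝ} {f g h : ℝ → ℂ} (hf : Integrable f μ)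
    (hg : Integrable g μ) (hh : Integrable h μ) :
    ∫ x, ‖f x - h x‖ ∂μ ≤ ∫ x, ‖f x - g x‖ ∂μ + ∫ x, ‖g x - h x‖ ∂μ := by
  rw [← integral_add (f := fun x => ‖f x - g x‖) (g := fun x => ‖g x - h x‖) (hf.sub hg).norm
    (hg.sub hh).norm]
  exact integral_mono (hf.sub hh).norm ((hf.sub hg).norm.add (hg.sub hh).norm)
    fun x => norm_sub_le_norm_sub_add_norm_sub _ _ _

theorem setIntegral_norm_le {f : ℝ → ℂ} (hf : Integrable f volPi) (E : Set ℝ) :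
    ∫ x in E, ‖f x‖ ∂volPi ≤ ∫ x, ‖f x‖ ∂volPi :=
  setIntegral_le_integral hf.norm (Eventually.of_forall fun _ => norm_nonneg _)

/-- A uniform bound on `E` costs a factor `2π < 7` in `L¹([-π, π])`. -/
theorem setIntegral_preimage_norm_le {p q : ℤ →₀ ℂ} {E : Set Torus} (hE : MeasurableSet E) {η : ℝ}
    (h : ∀ x ∈ E, ‖trigEval q x - trigEval p x‖ ≤ η) (hη : 0 ≤ η) :
    ∫ x in ((↑) : ℝ → Torus) ⁻¹' E, ‖trigFun q x - trigFun p x‖ ∂volPi ≤ 7 * η := by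
  have hm : MeasurableSet (((↑) : ℝ → Torus) ⁻¹' E) :=
    hE.preimage measurePreserving_coe_torus.measurable
  have h1 : ∫ x in ((↑) : ℝ → Torus) ⁻¹' E, ‖trigFun q x - trigFun p x‖ ∂volPi ≤
      ∫ x in ((↑) : ℝ → Torus) ⁻¹' E, η ∂volPi :=
    setIntegral_mono_on ((integrable_trigFun q).sub (integrable_trigFun p)).norm.integrableOn
      (integrable_const _) hm fun x hx => h x hx
  refine h1.trans ?_
  rw [setIntegral_const, smul_eq_mul]
  refine mul_le_mul_of_nonneg_right ?_ hη
  refine measureReal_mono (subset_univ _) |>.trans ?_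
  rw [measureReal_restrict_apply_univ, Real.volume_real_Icc_of_le (by linarith [Real.pi_pos])]
  linarith [Real.pi_lt_d2]

theorem volPi_preimage_compl_lt {E : Set Torus} (hE : MeasurableSet E) {η : ℝ} (hη : 0 < η)
    (h : torusMeasure.real Eᶜ < η / 10) :
    volPi (((↑) : ℝ → Torus) ⁻¹' E)ᶜ < ENNReal.ofReal η := by
  rw [← preimage_compl, volPi_preimage_coe hE.compl]
  refine (ENNReal.ofReal_lt_ofReal_iff hη).2 ?_
  have := Real.pi_lt_d2
  have := Real.pi_pos
  nlinarith [measureReal_nonneg (μ := torusMeasure) (s := Eᶜ)]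

/-- An integrable function agrees, up to a small error off a small set, with a trigonometric
polynomial of arbitrarily high spectrum and comparable `L¹` norm. -/
theorem exists_high_spectrum_near_integrable {f : ℝ → ℂ} (hf : Integrable f volPi) (N : ℕ) {η : ℝ}
    (hη : 0 < η) :
    ∃ (Q : ℤ →₀ ℂ) (E : Set ℝ), MeasurableSet E ∧ volPi Eᶜ < ENNReal.ofReal η ∧
      (∀ k : ℤ, |k| ≤ N → Q k = 0) ∧
      ∫ x, ‖trigFun Q x‖ ∂volPi ≤ 2 * ∫ x, ‖f x‖ ∂volPi + η ∧
      ∫ x in E, ‖trigFun Q x - f x‖ ∂volPi ≤ η := by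
  have hη' : 0 < η / 10 := by positivity
  obtain ⟨p, hp⟩ := exists_trigFun_near hf hη'
  obtain ⟨Q, E, hE, hEη, hQ, hQp, hQE⟩ := exists_high_spectrum_near p N hη'
  have hpf : ∫ x, ‖trigFun p x‖ ∂volPi ≤ ∫ x, ‖f x‖ ∂volPi + η / 10 := by
    have := integral_norm_sub_le (integrable_trigFun p) hf
      (integrable_zero ℝ ℂ volPi : Integrable (0 : ℝ → ℂ) volPi)
    simp only [Pi.zero_apply, sub_zero] at this
    linarith
  refine ⟨Q, _, hE.preimage measurePreserving_coe_torus.measurable,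
    volPi_preimage_compl_lt hE hη hEη, hQ, ?_, ?_⟩
  · have e1 : ∫ x, ‖trigFun Q x‖ ∂volPi = _ :=
      integral_coe_torus (f := fun y => ‖trigEval Q y‖) (by fun_prop)
    have e2 : ∫ x, ‖trigFun p x‖ ∂volPi = _ :=
      integral_coe_torus (f := fun y => ‖trigEval p y‖) (by fun_prop)
    rw [e1]
    rw [e2] at hpf
    have := Real.pi_lt_d2
    nlinarith [mul_le_mul_of_nonneg_left hQp Real.two_pi_pos.le]
  · refine (integral_norm_sub_le (integrable_trigFun Q).integrableOn
      (integrable_trigFun p).integrableOn hf.integrableOn).trans ?_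
    have h1 := setIntegral_preimage_norm_le hE hQE hη'.le
    have h2 := setIntegral_norm_le ((integrable_trigFun p).sub hf) (((↑) : ℝ → Torus) ⁻¹' E)
    simp only [Pi.sub_apply] at h2
    linarith

/-- An integrable function is, up to a small error off a small set, a sign transform of a
trigonometric polynomial with arbitrarily high spectrum and arbitrarily small `L¹` norm. -/
theorem exists_small_signMul_near_integrable {f : ℝ → ℂ} (hf : Integrable f volPi) (N : ℕ) {η : ℝ}
    (hη : 0 < η) :
    ∃ (Q : ℤ →₀ ℂ) (σ : ℤ → ℤˣ) (E : Set ℝ), MeasurableSet E ∧ volPi Eᶜ < ENNReal.ofReal η ∧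
      (∀ k : ℤ, |k| ≤ N → Q k = 0) ∧ ∫ x, ‖trigFun Q x‖ ∂volPi ≤ η ∧
      ∫ x in E, ‖trigFun (signMul σ Q) x - f x‖ ∂volPi ≤ η := by
  have hη' : 0 < η / 10 := by positivity
  obtain ⟨p, hp⟩ := exists_trigFun_near hf hη'
  obtain ⟨Q, σ, E, hE, hEη, hQ, hQp, hQE⟩ := exists_small_signMul_near p N hη'
  refine ⟨Q, σ, _, hE.preimage measurePreserving_coe_torus.measurable,
    volPi_preimage_compl_lt hE hη hEη, hQ, ?_, ?_⟩
  · have e1 : ∫ x, ‖trigFun Q x‖ ∂volPi = _ :=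
      integral_coe_torus (f := fun y => ‖trigEval Q y‖) (by fun_prop)
    rw [e1]
    have := Real.pi_lt_d2
    nlinarith [mul_le_mul_of_nonneg_left hQp Real.two_pi_pos.le]
  · refine (integral_norm_sub_le (integrable_trigFun _).integrableOn
      (integrable_trigFun p).integrableOn hf.integrableOn).trans ?_
    have h1 := setIntegral_preimage_norm_le hE hQE hη'.le
    have h2 := setIntegral_norm_le ((integrable_trigFun p).sub hf) (((↑) : ℝ → Torus) ⁻¹' E)
    simp only [Pi.sub_apply] at h2
    linarith

theorem abs_trigFreq_le {n M : ℕ} (h : n < 2 * M + 1) : |trigFreq n| ≤ M := by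
  obtain ⟨k, rfl | rfl⟩ := n.even_or_odd'
  · have : trigFreq (2 * k) = -(k : ℤ) := by
      rw [trigFreq, neg_inj, Equiv.symm_apply_eq]
      simp only [Equiv.intEquivNat, Equiv.trans_apply, Equiv.natSumNatEquivNat_apply]
      rfl
    rw [this, abs_neg, Nat.abs_cast]
    omega
  · have : trigFreq (2 * k + 1) = (k : ℤ) + 1 := by
      rw [trigFreq, neg_eq_iff_eq_neg, Equiv.symm_apply_eq, ← Int.negSucc_eq]
      simp [Equiv.intEquivNat, Equiv.intEquivNatSumNat]
    rw [this, abs_of_nonneg (by positivity)]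
    omega

theorem image_trigFreq_range (M : ℕ) :
    (Finset.range (2 * M + 1)).image trigFreq = Finset.Icc (-(M : ℤ)) M := by
  refine Finset.eq_of_subset_of_card_le (fun k hk => ?_) ?_
  · obtain ⟨n, hn, rfl⟩ := Finset.mem_image.1 hk
    exact Finset.mem_Icc.2 (abs_le.1 (abs_trigFreq_le (Finset.mem_range.1 hn)))
  · rw [Finset.card_image_of_injective _ trigFreq_injective, Finset.card_range, Int.card_Icc]
    omega

/-- The coefficient functionals of the trigonometric system read off the coefficients. -/
theorem coeff_trigFun (p : ℤ →₀ ℂ) (n : ℕ) : trigSystem.coeff n (trigFun p) = p (trigFreq n) := by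
  have hpi : (2 * π : ℂ) ≠ 0 := by simp [Real.pi_ne_zero]
  have h : ∀ x : ℝ, trigFun p x * trigSystem.ψ n x = ∑ k ∈ p.support,
      ((2 * π : ℂ)⁻¹ * p k) * Complex.exp (Complex.I * (k - trigFreq n : ℤ) * (x : ℂ)) := by
    intro x
    rw [trigFun_apply, Finset.sum_mul]
    refine Finset.sum_congr rfl fun k _ => ?_
    have : Complex.exp (Complex.I * (k - trigFreq n : ℤ) * (x : ℂ)) =
        Complex.exp (Complex.I * k * (x : ℂ)) * Complex.exp (-(Complex.I * trigFreq n * (x : ℂ))) := by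
      rw [← Complex.exp_add]
      congr 1
      push_cast
      ring
    rw [this]
    simp only [trigSystem]
    ring
  rw [BiorthonormalSystem.coeff]
  simp only [h]
  rw [integral_finsetSum _ fun k _ => (integrable_volPi (by fun_prop)).const_mul _]
  simp only [integral_const_mul, integral_exp_volPi, sub_eq_zero]
  rw [Finset.sum_eq_single (trigFreq n)]
  · rw [if_pos rfl, mul_right_comm, inv_mul_cancel₀ hpi, one_mul]
  · intro k _ hk
    rw [if_neg hk, mul_zero]
  · intro hk
    rw [Finsupp.notMem_support_iff.1 hk, mul_zero, zero_mul]

theorem norm_coeff_le {f : ℝ → ℂ} (hf : Integrable f volPi) (n : ℕ) :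
    ‖trigSystem.coeff n f‖ ≤ ∫ x, ‖f x‖ ∂volPi := by
  refine (norm_integral_le_integral_norm _).trans (integral_mono_of_nonneg
    (Eventually.of_forall fun _ => norm_nonneg _) hf.norm (Eventually.of_forall fun x => ?_))
  simp only [trigSystem, norm_mul, Complex.norm_exp]
  refine mul_le_of_le_one_right (norm_nonneg _) ?_
  simp only [norm_inv, norm_mul, Complex.norm_real, Complex.norm_ofNat]
  have : (2 * ‖π‖)⁻¹ ≤ 1 := inv_le_one_of_one_le₀ (by
    rw [Real.norm_of_nonneg Real.pi_pos.le]; linarith [Real.pi_gt_three])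
  simpa using this

theorem coeff_sub {f g : ℝ → ℂ} (hf : Integrable f volPi) (hg : Integrable g volPi) (n : ℕ) :
    trigSystem.coeff n (fun x => f x - g x) = trigSystem.coeff n f - trigSystem.coeff n g := by
  have hi : ∀ {f : ℝ → ℂ}, Integrable f volPi →
      Integrable (fun x => f x * trigSystem.ψ n x) volPi := fun hf =>
    hf.mul_of_top_left (trigSystem.memLp_top_ψ n)
  simp only [BiorthonormalSystem.coeff, sub_mul]
  exact integral_sub (hi hf) (hi hg)

/-- Partial sums over the symmetric frequency range `[-M, M]`, which are the first `2M + 1` terms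
of the trigonometric system. -/
theorem sum_range_trigSystem {M : ℕ} {p : ℤ →₀ ℂ} (hp : ∀ k, p k ≠ 0 → |k| ≤ M) (σ : ℤ → ℤˣ)
    {c : ℕ → ℂ} (hc : ∀ n, |trigFreq n| ≤ M → c n = p (trigFreq n)) (x : ℝ) :
    ∑ n ∈ Finset.range (2 * M + 1), ((σ (trigFreq n) : ℤ) : ℂ) * c n * trigSystem.φ n x =
      trigFun (signMul σ p) x := by
  have h1 : ∀ n ∈ Finset.range (2 * M + 1),
      ((σ (trigFreq n) : ℤ) : ℂ) * c n * trigSystem.φ n x =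
        signMul σ p (trigFreq n) * Complex.exp (Complex.I * trigFreq n * (x : ℂ)) := by
    intro n hn
    rw [hc n (abs_trigFreq_le (Finset.mem_range.1 hn))]
    rfl
  rw [Finset.sum_congr rfl h1,
    ← Finset.sum_image (f := fun k : ℤ => signMul σ p k * Complex.exp (Complex.I * k * (x : ℂ)))
      trigFreq_injective.injOn, image_trigFreq_range, trigFun_apply]
  symm
  refine Finset.sum_subset (fun k hk => ?_) fun k _ hk => ?_
  · have : p k ≠ 0 := right_ne_zero_of_mul (Finsupp.mem_support_iff.1 hk)
    exact Finset.mem_Icc.2 (abs_le.1 (hp k this))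
  · rw [Finsupp.notMem_support_iff.1 hk, zero_mul]

/-! ### The exceptional set and the sequence of blocks -/

theorem exists_dense_sequence_integrable : ∃ d : ℕ → ℝ → ℂ, (∀ i, Integrable (d i) volPi) ∧
    ∀ f : ℝ → ℂ, Integrable f volPi → ∀ η : ℝ, 0 < η → ∃ i, ∫ x, ‖d i x - f x‖ ∂volPi < η := by
  have : Fact ((1 : ENNReal) ≠ ⊤) := ⟨ENNReal.one_ne_top⟩
  refine ⟨fun i => TopologicalSpace.denseSeq (Lp ℂ 1 volPi) i,
    fun i => L1.integrable_coeFn _, fun f hf η hη => ?_⟩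
  obtain ⟨i, hi⟩ := (TopologicalSpace.denseRange_denseSeq (Lp ℂ 1 volPi)).exists_dist_lt
    (hf.toL1 f) hη
  refine ⟨i, ?_⟩
  rw [dist_comm, dist_eq_norm, L1.norm_eq_integral_norm] at hi
  refine lt_of_le_of_lt (le_of_eq (integral_congr_ae ?_)) hi
  filter_upwards [Lp.coeFn_sub (TopologicalSpace.denseSeq (Lp ℂ 1 volPi) i) (hf.toL1 f),
    hf.coeFn_toL1] with x h1 h2
  rw [h1, Pi.sub_apply, h2]

/-- `E` allows high frequency approximation if every integrable function can be approximated on `E`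
by trigonometric polynomials of arbitrarily high spectrum and comparable `L¹` norm. -/
def AllowsHighFrequencyApprox (E : Set ℝ) : Prop :=
  ∀ f : ℝ → ℂ, Integrable f volPi → ∀ (N : ℕ) (η : ℝ), 0 < η → ∃ Q : ℤ →₀ ℂ,
    (∀ k : ℤ, |k| ≤ N → Q k = 0) ∧ ∫ x, ‖trigFun Q x‖ ∂volPi ≤ 2 * ∫ x, ‖f x‖ ∂volPi + η ∧
    ∫ x in E, ‖trigFun Q x - f x‖ ∂volPi ≤ η

/-- The exceptional sets belonging to a countable dense family of functions, all degrees and all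
tolerances `1 / (l + 1)` can be made summably small, so one set serves all integrable functions. -/
theorem exists_allowsHighFrequencyApprox {ε : ℝ} (hε : 0 < ε) :
    ∃ E : Set ℝ, MeasurableSet E ∧ E ⊆ Icc (-π) π ∧
      volume (Icc (-π) π \ E) < ENNReal.ofReal ε ∧ AllowsHighFrequencyApprox E := by
  obtain ⟨d, hd, hdense⟩ := exists_dense_sequence_integrable
  obtain ⟨τ, hτ, hτε⟩ := ENNReal.exists_pos_sum_of_countable
    (ENNReal.ofReal_pos.2 hε).ne' (ℕ × ℕ × ℕ)
  have hpos : ∀ s : ℕ × ℕ × ℕ, 0 < min (τ s : ℝ) (1 / ((s.2.2 : ℝ) + 1)) := fun s =>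
    lt_min (hτ s) (by positivity)
  choose Q A hA hAτ hQN hQ1 hQA using fun s : ℕ × ℕ × ℕ =>
    exists_high_spectrum_near_integrable (hd s.1) s.2.1 (hpos s)
  refine ⟨Icc (-π) π ∩ ⋂ s, A s, measurableSet_Icc.inter (MeasurableSet.iInter hA),
    inter_subset_left, ?_, fun f hf N η hη => ?_⟩
  · have h1 : Icc (-π) π \ (Icc (-π) π ∩ ⋂ s, A s) = (⋂ s, A s)ᶜ ∩ Icc (-π) π := by
      rw [sdiff_self_inter, sdiff_eq, inter_comm]
    rw [h1, ← Measure.restrict_apply (MeasurableSet.iInter hA).compl, compl_iInter]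
    refine (measure_iUnion_le _).trans_lt (lt_of_le_of_lt (ENNReal.tsum_le_tsum fun s => ?_) hτε)
    refine (hAτ s).le.trans ((ENNReal.ofReal_le_ofReal (min_le_left _ _)).trans ?_)
    rw [ENNReal.ofReal_coe_nnreal]
  · obtain ⟨i, hi⟩ := hdense f hf (η / 4) (by positivity)
    obtain ⟨l, hl⟩ := exists_nat_one_div_lt (by positivity : 0 < η / 2)
    have hmin := (min_le_right (τ (i, N, l) : ℝ) (1 / ((l : ℝ) + 1)))
    refine ⟨Q (i, N, l), hQN (i, N, l), (hQ1 (i, N, l)).trans ?_, ?_⟩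
    · have := integral_norm_sub_le (hd i) hf
        (integrable_zero ℝ ℂ volPi : Integrable (0 : ℝ → ℂ) volPi)
      simp only [Pi.zero_apply, sub_zero] at this
      dsimp only
      linarith
    · refine (integral_norm_sub_le (integrable_trigFun _).integrableOn (hd i).integrableOn
        hf.integrableOn).trans ?_
      have h1 := setIntegral_norm_le ((hd i).sub hf) (Icc (-π) π ∩ ⋂ s, A s)
      simp only [Pi.sub_apply] at h1
      have h2 : ∫ x in Icc (-π) π ∩ ⋂ s, A s, ‖trigFun (Q (i, N, l)) x - d i x‖ ∂volPi ≤
          ∫ x in A (i, N, l), ‖trigFun (Q (i, N, l)) x - d i x‖ ∂volPi :=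
        setIntegral_mono_set ((integrable_trigFun _).sub (hd i)).norm.integrableOn
          (Eventually.of_forall fun _ => norm_nonneg _)
          (LE.le.eventuallyLE (inter_subset_right.trans (iInter_subset _ _)))
      have h3 := hQA (i, N, l)
      dsimp only at h3
      linarith

/-- A trigonometric polynomial with a degree bound and a choice of signs for its coefficients. -/
structure SignedPoly where
  /-- the coefficients -/
  poly : ℤ →₀ ℂ
  /-- a bound for the frequencies that occur -/
  degree : ℕ
  /-- the signs -/
  sign : ℤ → ℤˣ
  abs_le_degree : ∀ k, poly k ≠ 0 → |k| ≤ degree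

/-- `T` extends `S` if it agrees with `S` up to the degree of `S`, in coefficients and in signs. -/
def SignedPoly.Extends (T S : SignedPoly) : Prop :=
  S.degree ≤ T.degree ∧ ∀ k : ℤ, |k| ≤ S.degree → T.poly k = S.poly k ∧ T.sign k = S.sign k

theorem SignedPoly.Extends.trans {T S R : SignedPoly} (h : T.Extends S) (h' : S.Extends R) :
    T.Extends R :=
  ⟨h'.1.trans h.1, fun k hk =>
    have hk' : |k| ≤ S.degree := hk.trans (by exact_mod_cast h'.1)
    ⟨(h.2 k hk').1.trans (h'.2 k hk).1, (h.2 k hk').2.trans (h'.2 k hk).2⟩⟩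

theorem exists_degree_bound_gt (p : ℤ →₀ ℂ) (N : ℕ) : ∃ d : ℕ, N < d ∧ ∀ k, p k ≠ 0 → |k| ≤ d := by
  obtain ⟨d, hd⟩ := exists_degree_bound p
  refine ⟨max (N + 1) d, by simp, fun k hk => (hd k hk).trans ?_⟩
  exact_mod_cast le_max_right _ _

/-- A signed polynomial can be extended so that its plain values approximate `f` on `E`, while its
signed values approximate `g` off a small set. The first correction carries the signs `1` and
reduces the error on `E`; the second one is negligible in `L¹` before the signs are applied. -/
theorem SignedPoly.exists_extension {E : Set ℝ} (hEm : MeasurableSet E)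
    (hE : AllowsHighFrequencyApprox E) {f g : ℝ → ℂ}
    (hf : Integrable f volPi) (hg : Integrable g volPi) (S : SignedPoly) {η : ℝ} (hη : 0 < η) :
    ∃ (T : SignedPoly) (F : Set ℝ), T.Extends S ∧ S.degree < T.degree ∧
      ∫ x in E, ‖trigFun T.poly x - f x‖ ∂volPi ≤ η ∧
      ∫ x, ‖trigFun T.poly x - trigFun S.poly x‖ ∂volPi ≤
        2 * ∫ x in E, ‖trigFun S.poly x - f x‖ ∂volPi + η ∧
      MeasurableSet F ∧ volPi Fᶜ < ENNReal.ofReal η ∧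
      ∫ x in F, ‖trigFun (signMul T.sign T.poly) x - g x‖ ∂volPi ≤ η := by
  obtain ⟨P, M, δ, hP⟩ := S
  dsimp only
  have hη2 : 0 < η / 2 := by positivity
  have hfP : Integrable (fun x => f x - trigFun P x) volPi := hf.sub (integrable_trigFun P)
  obtain ⟨Q₁, hQ₁0, hQ₁1, hQ₁E⟩ := hE _ (hfP.indicator hEm) M _ hη2
  obtain ⟨M₁, hM₁, hPQ⟩ := exists_degree_bound_gt (P + Q₁) M
  obtain ⟨δ₁, hδ₁, hδ₁P⟩ := exists_signMul_add hP hQ₁0 δ 1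
  have hg' : Integrable (fun x => g x - trigFun (signMul δ₁ (P + Q₁)) x) volPi :=
    hg.sub (integrable_trigFun _)
  obtain ⟨Q₂, σ, F, hF, hFη, hQ₂0, hQ₂1, hQ₂F⟩ := exists_small_signMul_near_integrable hg' M₁ hη2
  obtain ⟨δ₂, hδ₂, hδ₂P⟩ := exists_signMul_add hPQ hQ₂0 δ₁ σ
  obtain ⟨M₂, hM₂, hPQ₂⟩ := exists_degree_bound_gt (P + Q₁ + Q₂) M₁
  refine ⟨⟨P + Q₁ + Q₂, M₂, δ₂, hPQ₂⟩, F, ⟨by dsimp only; omega, fun k hk => ?_⟩,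
    hM₁.trans hM₂, ?_, ?_, hF, hFη.trans_le (ENNReal.ofReal_le_ofReal (by linarith)), ?_⟩
  · dsimp only at hk ⊢
    have hk' : |k| ≤ M₁ := hk.trans (by exact_mod_cast hM₁.le)
    refine ⟨?_, (hδ₂ k hk').trans (hδ₁ k hk)⟩
    rw [Finsupp.add_apply, Finsupp.add_apply, hQ₁0 k hk, hQ₂0 k hk', add_zero, add_zero]
  · dsimp only
    have h1 : ∫ x in E, ‖trigFun (P + Q₁ + Q₂) x - f x‖ ∂volPi ≤
        ∫ x in E, (‖trigFun Q₁ x - E.indicator (fun x => f x - trigFun P x) x‖ + ‖trigFun Q₂ x‖)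
          ∂volPi := by
      refine setIntegral_mono_on ((integrable_trigFun _).sub hf).norm.integrableOn
        (((integrable_trigFun _).sub (hfP.indicator hEm)).norm.add
          (integrable_trigFun _).norm).integrableOn hEm fun x hx => ?_
      rw [indicator_of_mem hx]
      refine le_trans (le_of_eq ?_) (norm_add_le _ _)
      simp only [trigFun_add]
      congr 1
      ring
    have h2 := setIntegral_norm_le (integrable_trigFun Q₂) E
    refine h1.trans ?_
    rw [integral_add]
    · linarith
    · exact ((integrable_trigFun _).sub (hfP.indicator hEm)).norm.integrableOn
    · exact (integrable_trigFun _).norm.integrableOn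
  · dsimp only
    have h1 : ∫ x, ‖trigFun (P + Q₁ + Q₂) x - trigFun P x‖ ∂volPi ≤
        ∫ x, (‖trigFun Q₁ x‖ + ‖trigFun Q₂ x‖) ∂volPi := by
      refine integral_mono ((integrable_trigFun _).sub (integrable_trigFun _)).norm
        ((integrable_trigFun _).norm.add (integrable_trigFun _).norm) fun x => ?_
      refine le_trans (le_of_eq ?_) (norm_add_le _ _)
      simp only [trigFun_add]
      congr 1
      ring
    have h2 : ∫ x, ‖E.indicator (fun x => f x - trigFun P x) x‖ ∂volPi =
        ∫ x in E, ‖trigFun P x - f x‖ ∂volPi := by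
      rw [← integral_indicator hEm]
      refine integral_congr_ae (Eventually.of_forall fun x => ?_)
      simp only [norm_indicator_eq_indicator_norm, norm_sub_rev (f _)]
    refine h1.trans ?_
    rw [integral_add (integrable_trigFun _).norm (integrable_trigFun _).norm, ← h2]
    linarith
  · dsimp only
    refine le_trans (le_of_eq (integral_congr_ae (Eventually.of_forall fun x => ?_)))
      (hQ₂F.trans (by linarith))
    simp only [hδ₂P, trigFun_add]
    congr 1
    ring

/-- Iterated extension: the plain polynomials approach `f` on `E`, while the signed ones visit
a prescribed sequence of functions. -/
theorem exists_signedPoly_sequence {E : Set ℝ} (hEm : MeasurableSet E)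
    (hE : AllowsHighFrequencyApprox E) {f : ℝ → ℂ} (hf : Integrable f volPi) {g : ℕ → ℝ → ℂ}
    (hg : ∀ n, Integrable (g n) volPi) :
    ∃ (S : ℕ → SignedPoly) (F : ℕ → Set ℝ), (∀ i j, i ≤ j → (S j).Extends (S i)) ∧
      StrictMono (fun n => (S n).degree) ∧
      (∀ n, ∫ x in E, ‖trigFun (S n).poly x - f x‖ ∂volPi ≤ (1 / 2) ^ n) ∧
      (∀ n, ∫ x, ‖trigFun (S (n + 1)).poly x - trigFun (S n).poly x‖ ∂volPi ≤ 3 * (1 / 2) ^ n) ∧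
      (∀ n, MeasurableSet (F n)) ∧ (∀ n, volPi (F n)ᶜ ≤ ENNReal.ofReal ((1 / 2) ^ n)) ∧
      ∀ n, ∫ x in F n, ‖trigFun (signMul (S n).sign (S n).poly) x - g n x‖ ∂volPi ≤ (1 / 2) ^ n := by
  have hη : ∀ n : ℕ, (0 : ℝ) < (1 / 2) ^ n := fun n => by positivity
  choose next G h1 h2 h3 h4 h5 h6 h7 using fun (n : ℕ) (S : SignedPoly) =>
    SignedPoly.exists_extension hEm hE hf (hg n) S (hη n)
  let S₀ : SignedPoly := ⟨0, 0, 1, by simp⟩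
  let S : ℕ → SignedPoly := fun n => Nat.rec (next 0 S₀) (fun n T => next (n + 1) T) n
  let F : ℕ → Set ℝ := fun n => Nat.rec (G 0 S₀) (fun n _ => G (n + 1) (S n)) n
  have hSE : ∀ n, ∫ x in E, ‖trigFun (S n).poly x - f x‖ ∂volPi ≤ (1 / 2) ^ n := by
    rintro (_ | n)
    exacts [h3 0 S₀, h3 (n + 1) (S n)]
  have hext : ∀ i k, (S (i + k)).Extends (S i) := by
    intro i k
    induction k with
    | zero => exact ⟨le_rfl, fun _ _ => ⟨rfl, rfl⟩⟩
    | succ k ih => exact (h1 (i + k + 1) (S (i + k))).trans ih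
  refine ⟨S, F, fun i j hij => ?_, strictMono_nat_of_lt_succ fun n => h2 (n + 1) (S n), hSE,
    fun n => ?_, ?_, ?_, ?_⟩
  · obtain ⟨k, rfl⟩ := Nat.exists_eq_add_of_le hij
    exact hext i k
  · refine (h4 (n + 1) (S n)).trans ?_
    have := hSE n
    have : (1 / 2 : ℝ) ^ (n + 1) ≤ (1 / 2) ^ n :=
      pow_le_pow_of_le_one (by norm_num) (by norm_num) n.le_succ
    linarith
  · rintro (_ | n)
    exacts [h5 0 S₀, h5 (n + 1) (S n)]
  · rintro (_ | n)
    exacts [(h6 0 S₀).le, (h6 (n + 1) (S n)).le]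
  · rintro (_ | n)
    exacts [h7 0 S₀, h7 (n + 1) (S n)]

/-- Completeness of `L¹`, in terms of functions. -/
theorem exists_integrable_limit {u : ℕ → ℝ → ℂ} (hu : ∀ n, Integrable (u n) volPi)
    (h : ∀ n, ∫ x, ‖u (n + 1) x - u n x‖ ∂volPi ≤ 3 * (1 / 2) ^ n) :
    ∃ U : ℝ → ℂ, Integrable U volPi ∧
      Tendsto (fun n => ∫ x, ‖u n x - U x‖ ∂volPi) atTop (𝓝 0) := by
  have hdist : ∀ {f g : ℝ → ℂ} (hf : Integrable f volPi) (hg : Integrable g volPi),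
      dist (hf.toL1 f) (hg.toL1 g) = ∫ x, ‖f x - g x‖ ∂volPi := by
    intro f g hf hg
    rw [dist_eq_norm, ← Integrable.toL1_sub, L1.norm_eq_integral_norm]
    exact integral_congr_ae ((hf.sub hg).coeFn_toL1.mono fun x hx => by
      simp only [hx, Pi.sub_apply])
  have hc : CauchySeq fun n => (hu n).toL1 (u n) := by
    refine cauchySeq_of_le_geometric (1 / 2) 3 (by norm_num) fun n => ?_
    rw [dist_comm, hdist]
    exact h n
  obtain ⟨v, hv⟩ := cauchySeq_tendsto_of_complete hc
  have hvi := L1.integrable_coeFn v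
  refine ⟨v, hvi, ?_⟩
  rw [tendsto_iff_dist_tendsto_zero] at hv
  refine hv.congr fun n => ?_
  rw [← hdist (hu n) hvi, Integrable.toL1_coeFn]

/-! ### Universality -/

theorem trigSystem_coeff_congr {f g : ℝ → ℂ} (h : f =ᵐ[volPi] g) (n : ℕ) :
    trigSystem.coeff n f = trigSystem.coeff n g :=
  integral_congr_ae (h.mono fun x hx => by simp only [hx])

/-- Coefficients pass to `L¹` limits. -/
theorem tendsto_trigSystem_coeff {u : ℕ → ℝ → ℂ} {U : ℝ → ℂ} (hu : ∀ n, Integrable (u n) volPi)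
    (hU : Integrable U volPi)
    (h : Tendsto (fun n => ∫ x, ‖u n x - U x‖ ∂volPi) atTop (𝓝 0)) (n : ℕ) :
    Tendsto (fun j => trigSystem.coeff n (u j)) atTop (𝓝 (trigSystem.coeff n U)) := by
  rw [tendsto_iff_norm_sub_tendsto_zero]
  refine squeeze_zero (fun _ => norm_nonneg _) (fun j => ?_) h
  rw [← coeff_sub (hu j) hU]
  exact norm_coeff_le ((hu j).sub hU) n

/-- If `uₙ → U` in `L¹` and `uₙ → f` in `L¹(E)`, then `U = f` almost everywhere on `E`. -/
theorem ae_eq_of_tendsto_integral {E : Set ℝ} (hEm : MeasurableSet E) {f U : ℝ → ℂ}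
    {u : ℕ → ℝ → ℂ} (hf : Integrable f volPi) (hU : Integrable U volPi)
    (hu : ∀ n, Integrable (u n) volPi)
    (h : Tendsto (fun n => ∫ x, ‖u n x - U x‖ ∂volPi) atTop (𝓝 0))
    (h' : Tendsto (fun n => ∫ x in E, ‖u n x - f x‖ ∂volPi) atTop (𝓝 0)) :
    ∀ᵐ x ∂volPi, x ∈ E → U x = f x := by
  have hle : ∫ x in E, ‖U x - f x‖ ∂volPi ≤ 0 := by
    refine ge_of_tendsto (by simpa using h.add h') (Eventually.of_forall fun n => ?_)
    refine (integral_norm_sub_le hU.integrableOn (hu n).integrableOn hf.integrableOn).trans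
      (add_le_add_left ?_ _)
    simp only [norm_sub_rev (U _)]
    exact setIntegral_norm_le ((hu n).sub hU) E
  have h0 := le_antisymm hle (integral_nonneg fun _ => norm_nonneg _)
  rw [integral_eq_zero_iff_of_nonneg (f := fun x => ‖U x - f x‖) (fun _ => norm_nonneg _)
    (hU.sub hf).norm.integrableOn] at h0
  filter_upwards [(ae_restrict_iff' hEm).1 h0] with x hx hxE
  exact sub_eq_zero.1 (norm_eq_zero.1 (hx hxE))

/-- Tails of a sequence of sets with summable complements exhaust almost everything. -/
theorem tendsto_measure_compl_iInter {F : ℕ → Set ℝ}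
    (hF : ∀ n, volPi (F n)ᶜ ≤ ENNReal.ofReal ((1 / 2) ^ n)) :
    Tendsto (fun m => volPi (⋂ k, F (k + m))ᶜ) atTop (𝓝 0) := by
  refine tendsto_of_tendsto_of_tendsto_of_le_of_le tendsto_const_nhds
    (ENNReal.tendsto_sum_nat_add (fun n => ENNReal.ofReal ((1 / 2) ^ n))
      (summable_geometric_two.tsum_ofReal_ne_top)) (fun _ => zero_le) fun m => ?_
  dsimp only
  rw [compl_iInter]
  exact (measure_iUnion_le _).trans (ENNReal.tsum_le_tsum fun k => hF (k + m))

/-- If the spectral blocks of `U` end at stages `S n` whose signed values visit a sequence with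
every tail dense in `L¹`, up to errors tending to zero off sets of summable measure, then `U` is
universal. -/
theorem isAsymCondUniversal_of_sequence {U : ℝ → ℂ} (hU : Integrable U volPi)
    {S : ℕ → SignedPoly} (hS : ∀ i j, i ≤ j → (S j).Extends (S i))
    (hdeg : StrictMono fun n => (S n).degree)
    (hcoeff : ∀ j n, |trigFreq n| ≤ (S j).degree → trigSystem.coeff n U = (S j).poly (trigFreq n))
    {F : ℕ → Set ℝ} (hFm : ∀ n, MeasurableSet (F n))
    (hF : ∀ n, volPi (F n)ᶜ ≤ ENNReal.ofReal ((1 / 2) ^ n)) {g : ℕ → ℝ → ℂ}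
    (hg : ∀ n, Integrable (g n) volPi)
    (hgdense : ∀ f : ℝ → ℂ, Integrable f volPi → ∀ η : ℝ, 0 < η →
      ∃ᶠ k in atTop, ∫ x, ‖g k x - f x‖ ∂volPi < η)
    (hSg : ∀ n, ∫ x in F n, ‖trigFun (signMul (S n).sign (S n).poly) x - g n x‖ ∂volPi ≤
      (1 / 2) ^ n) :
    trigSystem.IsAsymCondUniversal {1, -1} U := by
  -- The sign at frequency `k` is read off at stage `|k|`, whose degree is at least `|k|`.
  set σ : ℤ → ℤˣ := fun k => (S k.natAbs).sign k with hσ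
  have hσS : ∀ j (k : ℤ), |k| ≤ (S j).degree → σ k = (S j).sign k := by
    intro j k hk
    have hk' : |k| ≤ (S k.natAbs).degree := by
      rw [Int.abs_eq_natAbs]
      exact_mod_cast hdeg.le_apply
    rcases le_total j k.natAbs with h | h
    · exact ((hS _ _ h).2 k hk).2
    · exact ((hS _ _ h).2 k hk').2.symm
  have hsum : ∀ j x, ∑ n ∈ Finset.range (2 * (S j).degree + 1),
      ((σ (trigFreq n) : ℤ) : ℂ) * trigSystem.coeff n U * trigSystem.φ n x =
        trigFun (signMul (S j).sign (S j).poly) x := by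
    intro j x
    rw [sum_range_trigSystem (S j).abs_le_degree σ (hcoeff j)]
    congr 1
    ext k
    by_cases hk : (S j).poly k = 0
    · simp [hk]
    · rw [signMul_apply, signMul_apply, hσS j k ((S j).abs_le_degree k hk)]
  refine ⟨hU, fun n => ((σ (trigFreq n) : ℤ) : ℂ), fun n => ?_, fun m => ⋂ k, F (k + m),
    fun m => MeasurableSet.iInter fun k => hFm _, fun m m' hm => ?_,
    tendsto_measure_compl_iInter hF, fun f hf => ?_⟩
  · rcases Int.units_eq_one_or (σ (trigFreq n)) with h | h <;> simp [h]
  · refine subset_iInter fun k => ?_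
    refine (iInter_subset _ (k + (m' - m))).trans (le_of_eq ?_)
    congr 1
    omega
  · obtain ⟨κ, hκ, hκf⟩ := extraction_forall_of_frequently fun q : ℕ =>
      hgdense f hf ((1 / 2) ^ q) (by positivity)
    refine ⟨fun q => 2 * (S (κ q)).degree + 1, fun a b hab => ?_, fun m => ?_⟩
    · have := hdeg (hκ hab)
      dsimp only at this ⊢
      omega
    simp only [hsum]
    have hlim : Tendsto (fun q : ℕ => (1 / 2 : ℝ) ^ q + (1 / 2) ^ q) atTop (𝓝 0) := by
      have := tendsto_pow_atTop_nhds_zero_of_lt_one (by norm_num : (0 : ℝ) ≤ 1 / 2) (by norm_num)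
      simpa using this.add this
    refine squeeze_zero' (Eventually.of_forall fun q => integral_nonneg fun _ => norm_nonneg _) ?_
      hlim
    filter_upwards [eventually_ge_atTop m] with q hq
    have hqκ : q ≤ κ q := hκ.le_apply
    refine (integral_norm_sub_le (integrable_trigFun _).integrableOn (hg (κ q)).integrableOn
      hf.integrableOn).trans (add_le_add ?_ ?_)
    · have hsub : ⋂ k, F (k + m) ⊆ F (κ q) := by
        refine (iInter_subset _ (κ q - m)).trans (le_of_eq ?_)
        congr 1
        omega
      refine (setIntegral_mono_set ((integrable_trigFun _).sub (hg _)).norm.integrableOn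
        (Eventually.of_forall fun _ => norm_nonneg _) hsub.eventuallyLE).trans ((hSg _).trans ?_)
      exact pow_le_pow_of_le_one (by norm_num) (by norm_num) hqκ
    · exact (setIntegral_norm_le ((hg (κ q)).sub hf) _).trans (hκf q).le

theorem corollary3 (ε : ℝ) (hε : 0 < ε) :
    ∃ E : Set ℝ, MeasurableSet E ∧ E ⊆ Icc (-π) π ∧
      volume (Icc (-π) π \ E) < ENNReal.ofReal ε ∧
      ∀ f : ℝ → ℂ, IntegrableOn f (Icc (-π) π) →
        ∃ U : ℝ → ℂ, IntegrableOn U (Icc (-π) π) ∧ (∀ x ∈ E, U x = f x) ∧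
          trigSystem.IsAsymCondUniversal {1, -1} U := by
  classical
  obtain ⟨E, hEm, hEI, hEε, hE⟩ := exists_allowsHighFrequencyApprox hε
  refine ⟨E, hEm, hEI, hEε, fun f hf => ?_⟩
  obtain ⟨d, hd, hdense⟩ := exists_dense_sequence_integrable
  -- Unpairing makes every element of the dense sequence occur infinitely often.
  obtain ⟨S, F, hext, hdeg, hSE, hSS, hFm, hF, hSg⟩ :=
    exists_signedPoly_sequence hEm hE hf (g := fun k => d k.unpair.1) fun k => hd _
  obtain ⟨V, hV, hSV⟩ := exists_integrable_limit (fun n => integrable_trigFun (S n).poly) hSS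
  have hSE0 : Tendsto (fun n => ∫ x in E, ‖trigFun (S n).poly x - f x‖ ∂volPi) atTop (𝓝 0) :=
    squeeze_zero (fun _ => integral_nonneg fun _ => norm_nonneg _) hSE
      (tendsto_pow_atTop_nhds_zero_of_lt_one (by norm_num) (by norm_num))
  have hVf := ae_eq_of_tendsto_integral hEm hf hV (fun n => integrable_trigFun _) hSV hSE0
  -- `V` equals `f` almost everywhere on `E`; a change on a null set makes them equal on `E`.
  have hUV : E.piecewise f V =ᵐ[volPi] V := by
    filter_upwards [hVf] with x hx
    by_cases hxE : x ∈ E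
    · rw [piecewise_eq_of_mem _ _ _ hxE, hx hxE]
    · rw [piecewise_eq_of_notMem _ _ _ hxE]
  have hU : Integrable (E.piecewise f V) volPi := hV.congr hUV.symm
  refine ⟨E.piecewise f V, hU, fun x hx => piecewise_eq_of_mem _ _ _ hx,
    isAsymCondUniversal_of_sequence hU hext hdeg (fun j n hn => ?_) hFm hF (fun k => hd _)
      (fun g hg η hη => ?_) hSg⟩
  · rw [trigSystem_coeff_congr hUV]
    refine tendsto_nhds_unique
      (tendsto_trigSystem_coeff (fun n => integrable_trigFun (S n).poly) hV hSV n) ?_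
    refine tendsto_const_nhds.congr' ?_
    filter_upwards [eventually_ge_atTop j] with i hi
    rw [coeff_trigFun, ((hext j i hi).2 _ hn).1]
  · obtain ⟨i, hi⟩ := hdense g hg η hη
    refine frequently_atTop.2 fun n => ⟨Nat.pair i n, Nat.right_le_pair i n, ?_⟩
    simpa only [Nat.unpair_pair] using hi
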